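/- Let $\Lambda$ be a countable discrete group. A function $\varphi:\Lambda\to\mathbb C$ is positive-definite if $(\varphi(g_i^{-1}g_j))_{i,j}$ is positive semi-definite for all $g_1,\dots,g_n\in\Lambda$. Let $\operatorname{PD}_1(\Lambda)$ be the set of positive-definite $\varphi$ with $\varphi(e)=1$, with the topology of pointwise convergence; $\Lambda$ acts on it by conjugation, $(g\cdot\varphi)(x)=\varphi(g^{-1}xg)$. A trace is a conjugation-invariant element of $\operatorname{PD}_1(\Lambda)$, and a character is an extreme point of the convex set of traces. A trace $\varphi$ with GNS triplet $(\mathcal H,\pi,\xi)$ (a unitary representation $\pi$ of $\Lambda$ on a Hilbert space $\mathcal H$ with cyclic vector $\xi$ such that $\varphi(g)=\langle\pi(g)\xi,\xi\rangle$) is von Neumann amenable if the von Neumann algebra $M=\pi(\Lambda)''$ is amenable, that is, if there is a conditional expectation $\mathcal B(\mathcal H)\to M$. Let $\operatorname{Rad}(\Lambda)$ be the amenable radical, the largest normal amenable subgroup of $\Lambda$. The countable group $\Lambda$ is charmenable if 1. every non-empty compact convex conjugation-invariant subset of $\operatorname{PD}_1(\Lambda)$ contains a trace, and 2. every character of $\Lambda$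 either vanishes outside $\operatorname{Rad}(\Lambda)$ or is von Neumann amenable. Let $\operatorname{Sub}(\Lambda)$ be the space of subgroups of $\Lambda$ with the Chabauty topology (induced from $\{0,1\}^\Lambda$), on which $\Lambda$ acts by conjugation. An IRS is a conjugation-invariant Borel probability measure on $\operatorname{Sub}(\Lambda)$, and a URS is a minimal non-empty closed conjugation-invariant subset of $\operatorname{Sub}(\Lambda)$. **Proposition.** Let $\Lambda$ be a charmenable group with Kazhdan's property (T), and assume that $\operatorname{Rad}(\Lambda)$ has only countably many subgroups. Then every ergodic IRS $\mu$ of $\Lambda$ is finitely supported (there is a finite set $F\subseteq\operatorname{Sub}(\Lambda)$ with $\mu(F)=1$), and every URS of $\Lambda$ is a finite set. -/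

import Mathlib

open scoped Pointwise ComplexOrder

universe u

namespace Charmenability

/-! ### Amenable groups and the amenable radical -/

/-- A (discrete) group is amenable if it carries a left-invariant mean, i.e. a finitely additive
left-invariant probability measure defined on all subsets. -/
def IsAmenableGroup (G : Type u) [Group G] : Prop :=
  ∃ m : Set G → ℝ, (∀ A, 0 ≤ m A) ∧ m Set.univ = 1 ∧
    (∀ A B, Disjoint A B → m (A ∪ B) = m A + m B) ∧
    ∀ (g : G) (A : Set G), m (g • A) = m A

/-- The amenable radical: the largest normal amenable subgroup, obtained as the join of all normal
amenable subgroups. -/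
def amenableRadical (G : Type u) [Group G] : Subgroup G :=
  sSup {N : Subgroup G | N.Normal ∧ IsAmenableGroup N}

/-! ### Positive-definite functions, traces, characters -/

/-- `φ` is positive-definite: every matrix `(φ (gᵢ⁻¹ gⱼ))ᵢⱼ` is positive semi-definite. -/
def IsPositiveDefinite {G : Type u} [Group G] (φ : G → ℂ) : Prop :=
  ∀ (n : ℕ) (g : Fin n → G), (Matrix.of fun i j => φ ((g i)⁻¹ * g j)).PosSemidef

/-- `PD₁(G)`: the normalized positive-definite functions, as a subset of `G → ℂ`, which carries the
topology of pointwise convergence. -/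
def PD₁ (G : Type u) [Group G] : Set (G → ℂ) :=
  {φ | IsPositiveDefinite φ ∧ φ 1 = 1}

/-- The conjugation action of `g` on functions: `(g · φ)(x) = φ (g⁻¹ x g)`. -/
def conjFun {G : Type u} [Group G] (g : G) (φ : G → ℂ) : G → ℂ :=
  fun x => φ (g⁻¹ * x * g)

/-- Traces: the conjugation invariant elements of `PD₁(G)`. -/
def traces (G : Type u) [Group G] : Set (G → ℂ) :=
  {φ | φ ∈ PD₁ G ∧ ∀ g, conjFun g φ = φ}

/-- Characters: the extreme points of the convex set of traces. -/
def characters (G : Type u) [Group G] : Set (G → ℂ) :=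
  Set.extremePoints ℝ (traces G)

/-! ### Unitary representations and von Neumann algebras -/

/-- Unitary representations of `G` on the Hilbert space `H`. -/
abbrev UnitaryRep (G : Type u) [Group G] (H : Type u) [NormedAddCommGroup H]
    [InnerProductSpace ℂ H] [CompleteSpace H] : Type u :=
  G →* unitary (H →L[ℂ] H)

section Representations

variable {G : Type u} [Group G] {H : Type u} [NormedAddCommGroup H] [InnerProductSpace ℂ H]
  [CompleteSpace H]

/-- The operators `π g`, `g ∈ G`. -/
def UnitaryRep.operators (π : UnitaryRep G H) : Set (H →L[ℂ] H) :=
  Set.range fun g : G => (π g : H →L[ℂ] H)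

/-- The von Neumann algebra `π(G)''` generated by a unitary representation. -/
noncomputable def UnitaryRep.vonNeumannAlgebra (π : UnitaryRep G H) : VonNeumannAlgebra H where
  toStarSubalgebra :=
    StarSubalgebra.centralizer ℂ (StarSubalgebra.centralizer ℂ π.operators : Set (H →L[ℂ] H))
  centralizer_centralizer' := by
    simp [StarSubalgebra.coe_centralizer]

/-- `π(G)''` is the double commutant of `π(G)`. -/
theorem UnitaryRep.coe_vonNeumannAlgebra (π : UnitaryRep G H) :
    (π.vonNeumannAlgebra : Set (H →L[ℂ] H)) = π.operators.centralizer.centralizer := by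
  have hstar : star π.operators = π.operators := by
    have hle : star π.operators ⊆ π.operators := by
      rintro x ⟨g, hg⟩
      refine ⟨g⁻¹, ?_⟩
      have : x = star (π g : H →L[ℂ] H) := by
        rw [← star_star x]; exact congrArg star hg.symm
      simp [this, map_inv, ← Unitary.star_eq_inv]
    refine hle.antisymm ?_
    simpa using Set.star_subset_star.2 hle
  change ((StarSubalgebra.centralizer ℂ (StarSubalgebra.centralizer ℂ π.operators :
    Set (H →L[ℂ] H)) : StarSubalgebra ℂ (H →L[ℂ] H)) : Set (H →L[ℂ] H)) = _
  have hstar' : star π.operators.centralizer = π.operators.centralizer := by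
    rw [Set.star_centralizer, hstar]
  simp [StarSubalgebra.coe_centralizer, hstar, hstar']

/-- `(H, π, ξ)` is a GNS triplet of `φ`: the vector `ξ` is cyclic and `φ(g) = ⟨π(g)ξ, ξ⟩`
(linear in the first variable; Mathlib's inner product is linear in the second one). -/
def IsGNSTriplet (φ : G → ℂ) (π : UnitaryRep G H) (ξ : H) : Prop :=
  (Submodule.span ℂ (Set.range fun g : G => (π g : H →L[ℂ] H) ξ)).topologicalClosure = ⊤ ∧
    ∀ g : G, φ g = inner ℂ ξ ((π g : H →L[ℂ] H) ξ)

/-- A conditional expectation of `B(H)` onto the von Neumann algebra `M`: a positive linear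
map onto `M` which is the identity on `M` and is `M`-bimodular. -/
structure IsConditionalExpectation (M : VonNeumannAlgebra H)
    (E : (H →L[ℂ] H) →ₗ[ℂ] (H →L[ℂ] H)) : Prop where
  mem : ∀ x, E x ∈ M
  apply_of_mem : ∀ x ∈ M, E x = x
  positive : ∀ x : H →L[ℂ] H, x.IsPositive → (E x).IsPositive
  bimodule : ∀ a ∈ M, ∀ b ∈ M, ∀ x, E (a * x * b) = a * E x * b

/-- A von Neumann algebra `M ⊆ B(H)` is amenable if there is a conditional expectation
of `B(H)` onto `M`. -/
def IsAmenableVN (M : VonNeumannAlgebra H) : Prop :=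
  ∃ E : (H →L[ℂ] H) →ₗ[ℂ] (H →L[ℂ] H), IsConditionalExpectation M E

end Representations

/-- A trace `φ` is von Neumann amenable if the von Neumann algebra `M = π(G)''` of its tracial
representation is amenable. Here `(H, π, ξ)` is a GNS triplet of `φ`, which exists and is unique
up to unitary equivalence, and the trace of `M` is `x ↦ ⟨x ξ, ξ⟩`. -/
def IsVonNeumannAmenable {G : Type u} [Group G] (φ : G → ℂ) : Prop :=
  ∃ (H : Type u) (_ : NormedAddCommGroup H) (_ : InnerProductSpace ℂ H) (_ : CompleteSpace H)
    (π : UnitaryRep G H) (ξ : H), IsGNSTriplet φ π ξ ∧ IsAmenableVN π.vonNeumannAlgebra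

/-! ### Charmenable groups and property (T) -/

/-- Charmenable groups. -/
structure IsCharmenable (G : Type u) [Group G] : Prop where
  countable : Countable G
  /-- Ubiquity of traces: every (non-empty) compact convex conjugation invariant subset of `PD₁(G)`
  contains a trace. -/
  ubiquity_of_traces : ∀ C : Set (G → ℂ), C ⊆ PD₁ G → C.Nonempty → IsCompact C → Convex ℝ C →
    (∀ g : G, ∀ φ ∈ C, conjFun g φ ∈ C) → ∃ φ ∈ C, φ ∈ traces G
  /-- Character dichotomy: every character vanishes outside the amenable radical or is
  von Neumann amenable. -/
  character_dichotomy : ∀ φ ∈ characters G,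
    (∀ g, g ∉ amenableRadical G → φ g = 0) ∨ IsVonNeumannAmenable φ

/-- Kazhdan's property (T) for a discrete group: there are a finite set `Q` and `ε > 0` such that
every unitary representation with a non-zero `(Q, ε)`-invariant vector has a non-zero
invariant vector. -/
def HasPropertyT (G : Type u) [Group G] : Prop :=
  ∃ (Q : Finset G) (ε : ℝ), 0 < ε ∧
    ∀ (H : Type u) [NormedAddCommGroup H] [InnerProductSpace ℂ H] [CompleteSpace H]
      (π : UnitaryRep G H),
      (∃ v : H, v ≠ 0 ∧ ∀ g ∈ Q, ‖(π g : H →L[ℂ] H) v - v‖ < ε * ‖v‖) →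
        ∃ v : H, v ≠ 0 ∧ ∀ g : G, (π g : H →L[ℂ] H) v = v

/-! ### The space of subgroups, IRS and URS -/

open Classical in
/-- The Chabauty topology on `Sub(G)` (`G` discrete): the topology induced by the embedding
into `{0,1}^G`, with `{0,1}` discrete. -/
noncomputable instance chabauty (G : Type u) [Group G] : TopologicalSpace (Subgroup G) :=
  TopologicalSpace.induced (fun (K : Subgroup G) (g : G) => decide (g ∈ K)) inferInstance

/-- `Sub(G)` carries its Borel σ-algebra. -/
noncomputable instance borelSub (G : Type u) [Group G] : MeasurableSpace (Subgroup G) :=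
  borel (Subgroup G)

/-- An invariant random subgroup: a Borel probability measure on `Sub(G)` that is invariant under
conjugation (`ConjAct G` is `G` acting by conjugation). -/
def IsIRS {G : Type u} [Group G] (μ : MeasureTheory.Measure (Subgroup G)) : Prop :=
  MeasureTheory.IsProbabilityMeasure μ ∧
    MeasureTheory.SMulInvariantMeasure (ConjAct G) (Subgroup G) μ

/-- An ergodic invariant random subgroup. -/
def IsErgodicIRS {G : Type u} [Group G] (μ : MeasureTheory.Measure (Subgroup G)) : Prop :=
  IsIRS μ ∧ ErgodicSMul (ConjAct G) (Subgroup G) μ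

/-- A set of subgroups that is non-empty, closed and invariant under conjugation. -/
def IsSubsystem {G : Type u} [Group G] (X : Set (Subgroup G)) : Prop :=
  X.Nonempty ∧ IsClosed X ∧ ∀ g : ConjAct G, ∀ K ∈ X, g • K ∈ X

/-- A uniformly recurrent subgroup: a minimal non-empty closed conjugation invariant subset
of `Sub(G)`. -/
def IsURS {G : Type u} [Group G] (X : Set (Subgroup G)) : Prop :=
  IsSubsystem X ∧ ∀ Y ⊆ X, IsSubsystem Y → Y = X

end Charmenability

namespace Charmenability

/-! ### Positive-definite functions -/

section PositiveDefinite

variable {G : Type u} [Group G]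

/-! Property (T) supplies one finite set Q whose lazy averaging operator contracts the complement of
the invariant vectors in every unitary representation, by a common factor r < 1. Through GNS, the
averages of any φ in PD₁ converge, at a rate r^k independent of φ, to the constant ‖pξ‖², where pξ
is the invariant part of the cyclic vector. Call φ null when this constant is 0. The uniform rate
makes nullity a closed condition on PD₁ (`HasGap.null_iff`), and a subgroup whose indicator is not
null has finite index (`HasGap.finiteIndex`).

The heart is that a non-negative null trace vanishes outside the amenable radical
(`IsCharmenable.eq_zero_of_null`). The traces τ such that τψ is null for all ψ in PD₁ form a closed
face of the traces; a non-negative null trace lies in it because |τψ| ≤ τ. By Krein–Milman only the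
extreme points χ of the face matter, and these are characters with χχ̄ null. Such a χ is not von
Neumann amenable (`HasGap.not_null_of_isVonNeumannAmenable`): a conditional expectation would give a
state on B(H) invariant under conjugation by π, hence by convexity and Powers–Størmer a
Hilbert–Schmidt unit vector almost fixed by Q, whereas nullity of χχ̄ spreads to its coefficient,
which the gap then keeps away from 1. The dichotomy leaves only vanishing outside the radical.

An IRS or a URS yields a non-negative trace built from indicators of subgroups: their integral, or a
trace in their closed convex hull found by ubiquity of traces. Either finite-index subgroups occur,
or the trace is null and places the subgroups inside the radical (for a URS first one of them, then
all by minimality). Both kinds are countable in number, since Q generates the group. For an ergodic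
measure a charged countable set gives an atom, whose orbit is finite and has full measure. For a
URS, a finite-index member has a finite orbit, and a countable minimal system is finite by Baire. -/

theorem isPositiveDefinite_iff {φ : G → ℂ} :
    IsPositiveDefinite φ ↔ (Matrix.of fun g h : G => φ (g⁻¹ * h)).PosSemidef := by
  constructor
  · intro hφ
    refine ⟨?_, fun x => ?_⟩
    · ext g h
      have := congrFun (congrFun (hφ 2 ![g, h]).isHermitian 0) 1
      simpa using this
    · have h := (hφ x.support.card fun i => (x.support.equivFin.symm i : G)).dotProduct_mulVec_nonneg
        (fun i => x (x.support.equivFin.symm i))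
      have key : ∀ f : G → ℂ, ∑ i, f (x.support.equivFin.symm i) = ∑ g ∈ x.support, f g := fun f => by
        rw [Equiv.sum_comp x.support.equivFin.symm (fun g : x.support => f g)]
        exact Finset.sum_coe_sort x.support f
      simp only [dotProduct, Matrix.mulVec, Matrix.of_apply, Pi.star_apply] at h
      rw [key fun g => star (x g) * ∑ j, φ (g⁻¹ * (x.support.equivFin.symm j : G)) *
        x (x.support.equivFin.symm j)] at h
      simp_rw [fun g => key fun k => φ (g⁻¹ * k) * x k] at h
      simpa [Finsupp.sum, Finset.mul_sum, mul_assoc] using h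
  · intro h n g
    exact h.submatrix g

theorem IsPositiveDefinite.mul {φ ψ : G → ℂ} (hφ : IsPositiveDefinite φ)
    (hψ : IsPositiveDefinite ψ) : IsPositiveDefinite (φ * ψ) :=
  fun n g => (hφ n g).hadamard (hψ n g)

theorem IsPositiveDefinite.apply_inv {φ : G → ℂ} (hφ : IsPositiveDefinite φ) (g : G) :
    φ g⁻¹ = star (φ g) := by
  have := congrFun (congrFun (hφ 2 ![1, g]).isHermitian 1) 0
  simpa using this.symm

theorem IsPositiveDefinite.star {φ : G → ℂ} (hφ : IsPositiveDefinite φ) :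
    IsPositiveDefinite (star φ) := by
  intro n g
  have : (Matrix.of fun i j => Star.star φ ((g i)⁻¹ * g j)) =
      (Matrix.of fun i j => φ ((g i)⁻¹ * g j)).transpose := by
    ext i j
    simpa using (hφ.apply_inv ((g i)⁻¹ * g j)).symm
  rw [this]
  exact (hφ n g).transpose

theorem mul_mem_PD₁ {φ ψ : G → ℂ} (hφ : φ ∈ PD₁ G) (hψ : ψ ∈ PD₁ G) : φ * ψ ∈ PD₁ G :=
  ⟨hφ.1.mul hψ.1, by simp [hφ.2, hψ.2]⟩

theorem star_mem_PD₁ {φ : G → ℂ} (hφ : φ ∈ PD₁ G) : star φ ∈ PD₁ G :=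
  ⟨hφ.1.star, by simp [hφ.2]⟩

end PositiveDefinite

/-! ### Isometries determined by Gram matrices, and the GNS construction -/

section Isometry

open scoped InnerProductSpace

/-- Equal Gram matrices give equal norms to corresponding linear combinations, so the assignment
extends by density. It serves twice: for the left translations of the GNS construction, and for the
right translations attached to a trace, which lie in the commutant. -/
theorem exists_isometry_of_inner_eq {ι H H' : Type*} [NormedAddCommGroup H] [InnerProductSpace ℂ H]
    [NormedAddCommGroup H'] [InnerProductSpace ℂ H'] [CompleteSpace H'] {v : ι → H} {w : ι → H'}
    (hv : (Submodule.span ℂ (Set.range v)).topologicalClosure = ⊤)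
    (h : ∀ i j, inner ℂ (v i) (v j) = inner ℂ (w i) (w j)) :
    ∃ V : H →L[ℂ] H', (∀ i, V (v i) = w i) ∧ ∀ x, ‖V x‖ = ‖x‖ := by
  have hd : DenseRange (Finsupp.linearCombination ℂ v) := by
    rw [DenseRange, ← LinearMap.coe_range, Finsupp.range_linearCombination]
    exact Submodule.dense_iff_topologicalClosure_eq_top.2 hv
  have hn : ∀ x, ‖Finsupp.linearCombination ℂ w x‖ = ‖Finsupp.linearCombination ℂ v x‖ := by
    intro x
    rw [norm_eq_sqrt_re_inner (𝕜 := ℂ), norm_eq_sqrt_re_inner (𝕜 := ℂ)]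
    simp [-inner_self_eq_norm_sq_to_K, Finsupp.linearCombination_apply, Finsupp.sum_inner,
      Finsupp.inner_sum, h]
  have hE := fun x => LinearMap.extendOfNorm_eq hd ⟨1, fun x => by rw [one_mul, hn]⟩ x
  refine ⟨(Finsupp.linearCombination ℂ w).extendOfNorm (Finsupp.linearCombination ℂ v),
    fun i => by simpa using hE (Finsupp.single i 1), fun x => ?_⟩
  refine hd.induction_on (p := fun x => ‖((Finsupp.linearCombination ℂ w).extendOfNorm
    (Finsupp.linearCombination ℂ v)) x‖ = ‖x‖) x (isClosed_eq (by fun_prop) (by fun_prop)) ?_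
  intro y
  rw [hE, hn]

theorem clm_ext_of_dense_span {ι H H' : Type*} [NormedAddCommGroup H] [InnerProductSpace ℂ H]
    [NormedAddCommGroup H'] [InnerProductSpace ℂ H'] {v : ι → H} {S T : H →L[ℂ] H'}
    (hv : (Submodule.span ℂ (Set.range v)).topologicalClosure = ⊤)
    (h : ∀ i, S (v i) = T (v i)) : S = T :=
  ContinuousLinearMap.ext_on (Submodule.dense_iff_topologicalClosure_eq_top.2 hv)
    (by rintro _ ⟨i, rfl⟩; exact h i)

variable {G : Type u} [Group G] {H : Type u} [NormedAddCommGroup H] [InnerProductSpace ℂ H]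
  [CompleteSpace H]

/-- A homomorphism to the isometries of a Hilbert space is a unitary representation. -/
noncomputable def unitaryRepOfIsometry (T : G →* (H →L[ℂ] H)) (hT : ∀ g x, ‖T g x‖ = ‖x‖) :
    UnitaryRep G H :=
  T.codRestrict (unitary (H →L[ℂ] H)) fun g => by
    have h1 : ∀ g, star (T g) * T g = 1 := fun g =>
      (ContinuousLinearMap.norm_map_iff_adjoint_comp_self (T g)).1 (hT g)
    have h2 : T g * T g⁻¹ = 1 := by rw [← map_mul]; simp
    have h3 : star (T g) = T g⁻¹ := by
      rw [← mul_one (star (T g)), ← h2, ← mul_assoc, h1, one_mul]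
    exact Unitary.mem_iff.2 ⟨h1 g, by rw [h3, h2]⟩

@[simp]
theorem unitaryRepOfIsometry_apply (T : G →* (H →L[ℂ] H)) (hT : ∀ g x, ‖T g x‖ = ‖x‖) (g : G) :
    (unitaryRepOfIsometry T hT g : H →L[ℂ] H) = T g := rfl

theorem UnitaryRep.norm_apply (π : UnitaryRep G H) (g : G) (x : H) :
    ‖(π g : H →L[ℂ] H) x‖ = ‖x‖ :=
  (ContinuousLinearMap.norm_map_iff_adjoint_comp_self _).2 (Unitary.coe_star_mul_self (π g)) x

theorem UnitaryRep.mul_apply (π : UnitaryRep G H) (g h : G) (x : H) :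
    (π (g * h) : H →L[ℂ] H) x = (π g : H →L[ℂ] H) ((π h : H →L[ℂ] H) x) := by
  simp

theorem UnitaryRep.star_apply (π : UnitaryRep G H) (g : G) :
    star (π g : H →L[ℂ] H) = (π g⁻¹ : H →L[ℂ] H) := by
  rw [map_inv, ← Unitary.star_eq_inv, Unitary.coe_star]

theorem UnitaryRep.inner_apply_right (π : UnitaryRep G H) (g : G) (x y : H) :
    inner ℂ x ((π g : H →L[ℂ] H) y) = inner ℂ ((π g⁻¹ : H →L[ℂ] H) x) y := by
  rw [← π.star_apply, ContinuousLinearMap.star_eq_adjoint, ContinuousLinearMap.adjoint_inner_left]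

theorem UnitaryRep.inner_apply_apply (π : UnitaryRep G H) (g h : G) (x y : H) :
    inner ℂ ((π g : H →L[ℂ] H) x) ((π h : H →L[ℂ] H) y) =
      inner ℂ x ((π (g⁻¹ * h) : H →L[ℂ] H) y) := by
  rw [π.inner_apply_right, π.inner_apply_right (g⁻¹ * h), mul_inv_rev, inv_inv, π.mul_apply]

/-- Kolmogorov decomposition: a positive-definite function is a Gram matrix of a total family. -/
theorem IsPositiveDefinite.exists_gram {φ : G → ℂ} (hφ : IsPositiveDefinite φ) :
    ∃ (H : Type u) (_ : NormedAddCommGroup H) (_ : InnerProductSpace ℂ H) (_ : CompleteSpace H)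
      (v : G → H), (Submodule.span ℂ (Set.range v)).topologicalClosure = ⊤ ∧
        ∀ g h, inner ℂ (v g) (v h) = φ (g⁻¹ * h) := by
  let K : Matrix G G (ℂ →L[ℂ] ℂ) := Matrix.of fun g h => φ (g⁻¹ * h) • (1 : ℂ →L[ℂ] ℂ)
  have hφ' := isPositiveDefinite_iff.1 hφ
  have hK : K.PosSemidef := by
    refine ((RKHS.posSemidef_tfae (𝕜 := ℂ) (K := K)).out 0 2).2 (And.intro ?_ fun x => ?_)
    · ext g h
      simpa [K] using (hφ.apply_inv (h⁻¹ * g)).symm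
    · have h := (Complex.le_def.1 (hφ'.2 x)).1
      refine h.trans_eq (congrArg Complex.re ?_)
      refine Finsupp.sum_congr fun g _ => Finsupp.sum_congr fun k _ => ?_
      have := hφ.apply_inv (k⁻¹ * g)
      simp only [mul_inv_rev, inv_inv] at this
      simp [K, this]
      ring
  have : Fact K.PosSemidef := ⟨hK⟩
  refine ⟨RKHS.OfKernel K, inferInstance, inferInstance, inferInstance,
    fun g => RKHS.kerFun (RKHS.OfKernel K) g 1, ?_, fun g h => ?_⟩
  · rw [← top_le_iff, ← RKHS.kerFun_dense (RKHS.OfKernel K)]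
    refine Submodule.topologicalClosure_mono (Submodule.span_le.2 ?_)
    rintro _ ⟨x, v, rfl⟩
    have : RKHS.kerFun (RKHS.OfKernel K) x v = v • RKHS.kerFun (RKHS.OfKernel K) x 1 := by
      rw [← map_smul]; simp
    rw [this]
    exact Submodule.smul_mem _ _ (Submodule.subset_span ⟨x, rfl⟩)
  · rw [← RKHS.kernel_inner, RKHS.OfKernel.kernel_ofKernel]
    simpa [K] using (hφ.apply_inv (h⁻¹ * g)).symm

theorem IsPositiveDefinite.exists_isGNSTriplet {φ : G → ℂ} (hφ : IsPositiveDefinite φ) :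
    ∃ (H : Type u) (_ : NormedAddCommGroup H) (_ : InnerProductSpace ℂ H) (_ : CompleteSpace H)
      (π : UnitaryRep G H) (ξ : H), IsGNSTriplet φ π ξ := by
  obtain ⟨H, _, _, _, v, hv, hg⟩ := hφ.exists_gram
  choose T hT hTn using fun g : G => exists_isometry_of_inner_eq (w := fun h => v (g * h)) hv
    (fun i j => by rw [hg, hg]; group)
  let T' : G →* (H →L[ℂ] H) :=
    { toFun := T
      map_one' := clm_ext_of_dense_span hv fun i => by simp [hT]
      map_mul' := fun g h => clm_ext_of_dense_span hv fun i => by simp [hT, mul_assoc] }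
  refine ⟨H, _, _, _, unitaryRepOfIsometry T' hTn, v 1, ?_, fun g => ?_⟩
  · simpa [T', hT] using hv
  · simp [T', hT, hg]

theorem IsGNSTriplet.norm_eq_one {φ : G → ℂ} {π : UnitaryRep G H} {ξ : H}
    (h : IsGNSTriplet φ π ξ) (hφ : φ 1 = 1) : ‖ξ‖ = 1 := by
  have := h.2 1
  rw [hφ] at this
  simp only [map_one, OneMemClass.coe_one, one_apply_eq_self, inner_self_eq_norm_sq_to_K] at this
  have h2 : ‖ξ‖ ^ 2 = 1 := by
    have h3 : ((‖ξ‖ ^ 2 : ℝ) : ℂ) = 1 := by simpa using this.symm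
    exact_mod_cast h3
  exact (pow_eq_one_iff_of_nonneg (norm_nonneg _) two_ne_zero).1 h2

theorem norm_le_one_of_mem_PD₁ {φ : G → ℂ} (hφ : φ ∈ PD₁ G) (g : G) : ‖φ g‖ ≤ 1 := by
  obtain ⟨H, _, _, _, π, ξ, h⟩ := hφ.1.exists_isGNSTriplet
  rw [h.2 g]
  refine (norm_inner_le_norm _ _).trans_eq ?_
  rw [π.norm_apply, h.norm_eq_one hφ.2, one_mul]

end Isometry

/-! ### Averaging operators and the spectral gap of property (T) -/

section SpectralGap

variable {G : Type u} [Group G]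

/-- The lazy averaging operator over right translates by `Q`, acting on functions. -/
noncomputable def avg (Q : Finset G) : (G → ℂ) →ₗ[ℂ] (G → ℂ) where
  toFun φ g := ((Q.card : ℂ) + 1)⁻¹ * (φ g + ∑ q ∈ Q, φ (g * q))
  map_add' φ ψ := by
    ext g
    simp only [Pi.add_apply, Finset.sum_add_distrib]
    ring
  map_smul' c φ := by
    ext g
    simp only [Pi.smul_apply, smul_eq_mul, ← Finset.mul_sum, RingHom.id_apply]
    ring

theorem avg_apply (Q : Finset G) (φ : G → ℂ) (g : G) :
    avg Q φ g = ((Q.card : ℂ) + 1)⁻¹ * (φ g + ∑ q ∈ Q, φ (g * q)) := rfl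

variable {H : Type u} [NormedAddCommGroup H] [InnerProductSpace ℂ H] [CompleteSpace H]

/-- The lazy averaging operator over `Q` in a unitary representation. -/
noncomputable def avgOp (Q : Finset G) (π : UnitaryRep G H) : H →L[ℂ] H :=
  ((Q.card : ℂ) + 1)⁻¹ • (1 + ∑ q ∈ Q, (π q : H →L[ℂ] H))

theorem avgOp_apply (Q : Finset G) (π : UnitaryRep G H) (v : H) :
    avgOp Q π v = ((Q.card : ℂ) + 1)⁻¹ • (v + ∑ q ∈ Q, (π q : H →L[ℂ] H) v) := by
  simp [avgOp]

theorem avg_coefficient (Q : Finset G) (π : UnitaryRep G H) (x y : H) :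
    avg Q (fun g => inner ℂ x ((π g : H →L[ℂ] H) y)) =
      fun g => inner ℂ x ((π g : H →L[ℂ] H) (avgOp Q π y)) := by
  ext g
  simp only [avg_apply, avgOp_apply, map_smul, map_add, map_sum, inner_smul_right, inner_add_right,
    inner_sum, π.mul_apply]

theorem avg_pow_coefficient (Q : Finset G) (π : UnitaryRep G H) (x y : H) (k : ℕ) :
    (avg Q ^ k) (fun g => inner ℂ x ((π g : H →L[ℂ] H) y)) =
      fun g => inner ℂ x ((π g : H →L[ℂ] H) ((avgOp Q π ^ k) y)) := by
  induction k generalizing y with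
  | zero => simp
  | succ k ih => rw [pow_succ, Module.End.mul_apply, avg_coefficient, ih, pow_succ]; rfl

/-- The invariant vectors of a unitary representation. -/
def UnitaryRep.invariants (π : UnitaryRep G H) : Submodule ℂ H where
  carrier := {v | ∀ g, (π g : H →L[ℂ] H) v = v}
  add_mem' hv hw g := by rw [map_add, hv g, hw g]
  zero_mem' g := map_zero _
  smul_mem' c v hv g := by rw [map_smul, hv g]

theorem UnitaryRep.isClosed_invariants (π : UnitaryRep G H) :
    IsClosed (π.invariants : Set H) := by
  have : (π.invariants : Set H) = ⋂ g, {v | (π g : H →L[ℂ] H) v = v} := by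
    ext v; simp [UnitaryRep.invariants]
  rw [this]
  exact isClosed_iInter fun g => isClosed_eq (by fun_prop) continuous_id

theorem UnitaryRep.apply_mem_orthogonal (π : UnitaryRep G H) {v : H}
    (hv : v ∈ π.invariantsᗮ) (g : G) : (π g : H →L[ℂ] H) v ∈ π.invariantsᗮ := by
  intro w hw
  rw [π.inner_apply_right, hw g⁻¹]
  exact hv w hw

/-- The restriction of a unitary representation to the complement of the invariant vectors. -/
noncomputable def UnitaryRep.complement (π : UnitaryRep G H) : UnitaryRep G π.invariantsᗮ :=
  unitaryRepOfIsometry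
    { toFun := fun g => ((π g : H →L[ℂ] H).comp π.invariantsᗮ.subtypeL).codRestrict _
        fun v => π.apply_mem_orthogonal v.2 g
      map_one' := by ext; simp
      map_mul' := fun g h => by ext; simp; rfl }
    fun g v => π.norm_apply g v

/-- Property (T) is applied to the restriction to the complement of the invariants: an almost
invariant vector there would produce a non-zero invariant vector orthogonal to itself. -/
theorem exists_le_norm_sub_of_mem_orthogonal {Q : Finset G} {ε : ℝ}
    (hQ : ∀ (H : Type u) [NormedAddCommGroup H] [InnerProductSpace ℂ H] [CompleteSpace H]
      (π : UnitaryRep G H),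
      (∃ v : H, v ≠ 0 ∧ ∀ g ∈ Q, ‖(π g : H →L[ℂ] H) v - v‖ < ε * ‖v‖) →
        ∃ v : H, v ≠ 0 ∧ ∀ g : G, (π g : H →L[ℂ] H) v = v)
    (π : UnitaryRep G H) {v : H} (hv : v ∈ π.invariantsᗮ) (hv0 : v ≠ 0) :
    ∃ q ∈ Q, ε * ‖v‖ ≤ ‖(π q : H →L[ℂ] H) v - v‖ := by
  by_contra! hcon
  obtain ⟨w, hw0, hw⟩ := hQ _ π.complement ⟨⟨v, hv⟩, by simpa using hv0, fun g hg => hcon g hg⟩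
  have hw' : (w : H) ∈ π.invariants := fun g => congrArg Subtype.val (hw g)
  have := w.2 w hw'
  exact hw0 (Subtype.ext (inner_self_eq_zero.1 this))

/-- The lazy term v is paired with the one π(q)v that is far from it, and the parallelogram law
makes their sum shorter than 2‖v‖. The remaining terms are estimated trivially. -/
theorem norm_avgOp_le {Q : Finset G} {π : UnitaryRep G H} {v : H} {ε : ℝ}
    (h : ∃ q ∈ Q, ε * ‖v‖ ≤ ‖(π q : H →L[ℂ] H) v - v‖) (hε : 0 < ε) :
    ‖avgOp Q π v‖ ≤ (√(4 - ε ^ 2) + Q.card - 1) / (Q.card + 1) * ‖v‖ := by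
  classical
  obtain ⟨q, hq, hqv⟩ := h
  have h1 : ‖v + (π q : H →L[ℂ] H) v‖ ≤ √(4 - ε ^ 2) * ‖v‖ := by
    have hp := parallelogram_law_with_norm ℂ v ((π q : H →L[ℂ] H) v)
    rw [π.norm_apply, norm_sub_rev] at hp
    have hsq : (ε * ‖v‖) * (ε * ‖v‖) ≤
        ‖(π q : H →L[ℂ] H) v - v‖ * ‖(π q : H →L[ℂ] H) v - v‖ :=
      mul_self_le_mul_self (by positivity) hqv
    have h2 : ‖v + (π q : H →L[ℂ] H) v‖ ^ 2 ≤ (4 - ε ^ 2) * ‖v‖ ^ 2 := by nlinarith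
    calc ‖v + (π q : H →L[ℂ] H) v‖ = √(‖v + (π q : H →L[ℂ] H) v‖ ^ 2) :=
          (Real.sqrt_sq (norm_nonneg _)).symm
      _ ≤ √((4 - ε ^ 2) * ‖v‖ ^ 2) := Real.sqrt_le_sqrt h2
      _ = _ := by rw [Real.sqrt_mul' _ (by positivity), Real.sqrt_sq (norm_nonneg _)]
  have h3 : ‖∑ p ∈ Q.erase q, (π p : H →L[ℂ] H) v‖ ≤ (Q.card - 1) * ‖v‖ := by
    refine (norm_sum_le _ _).trans_eq ?_
    simp [π.norm_apply, Finset.card_erase_of_mem hq,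
      Nat.cast_sub (Finset.card_pos.2 ⟨q, hq⟩)]
  rw [avgOp_apply, norm_smul, ← Finset.add_sum_erase _ _ hq, ← add_assoc, div_mul_eq_mul_div,
    div_eq_inv_mul]
  have h4 : ‖((Q.card : ℂ) + 1)⁻¹‖ = ((Q.card : ℝ) + 1)⁻¹ := by
    rw [norm_inv]; norm_cast
  rw [h4]
  gcongr
  refine (norm_add_le _ _).trans ?_
  linarith

theorem avgOp_mem_orthogonal (Q : Finset G) (π : UnitaryRep G H) {v : H}
    (hv : v ∈ π.invariantsᗮ) : avgOp Q π v ∈ π.invariantsᗮ := by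
  rw [avgOp_apply]
  exact Submodule.smul_mem _ _ (Submodule.add_mem _ hv
    (Submodule.sum_mem _ fun q _ => π.apply_mem_orthogonal hv q))

theorem avgOp_of_mem_invariants (Q : Finset G) (π : UnitaryRep G H) {v : H}
    (hv : v ∈ π.invariants) : avgOp Q π v = v := by
  rw [avgOp_apply, Finset.sum_congr rfl fun q _ => hv q, Finset.sum_const, ← Nat.cast_smul_eq_nsmul ℂ]
  have : (Q.card : ℂ) + 1 ≠ 0 := by norm_cast
  rw [show v + (Q.card : ℂ) • v = ((Q.card : ℂ) + 1) • v by rw [add_smul, one_smul, add_comm],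
    smul_smul, inv_mul_cancel₀ this, one_smul]

/-- The averages of normalized positive-definite functions over the powers of `Q` converge
uniformly, at rate `r`, to a non-negative constant. -/
def HasGap (Q : Finset G) (r : ℝ) : Prop :=
  0 ≤ r ∧ r < 1 ∧ ∀ φ ∈ PD₁ G, ∃ c : ℝ, 0 ≤ c ∧ ∀ k g, ‖(avg Q ^ k) φ g - c‖ ≤ r ^ k

/-- Split the cyclic vector as ξ = p + (ξ - p) with p invariant. The averages fix p, which
contributes ⟨ξ, π(g)p⟩ = ‖p‖² at every g, and they shrink ξ - p by r at each step. -/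
theorem HasPropertyT.exists_hasGap (hT : HasPropertyT G) :
    ∃ (Q : Finset G) (r : ℝ), HasGap Q r := by
  obtain ⟨Q, ε, hε, hQ⟩ := hT
  -- The maximum with 0 matters only for empty Q, where the quotient can be negative.
  set r : ℝ := max ((√(4 - ε ^ 2) + Q.card - 1) / (Q.card + 1)) 0 with hr
  have hr0 : 0 ≤ r := le_max_right _ _
  have hr1 : r < 1 := by
    refine max_lt ?_ one_pos
    have : √(4 - ε ^ 2) < 2 := (Real.sqrt_lt' two_pos).2 (by nlinarith)
    rw [div_lt_one (by positivity)]
    linarith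
  refine ⟨Q, r, hr0, hr1, fun φ hφ => ?_⟩
  obtain ⟨H, _, _, _, π, ξ, hGNS⟩ := hφ.1.exists_isGNSTriplet
  have hξ := hGNS.2
  have hgap : ∀ (k : ℕ) (v : H), v ∈ π.invariantsᗮ → ‖(avgOp Q π ^ k) v‖ ≤ r ^ k * ‖v‖ := by
    intro k
    induction k with
    | zero => simp
    | succ k ih =>
      intro v hv
      rw [pow_succ, mul_apply_eq_comp]
      refine (ih _ (avgOp_mem_orthogonal Q π hv)).trans ?_
      rw [pow_succ, mul_assoc]
      gcongr
      rcases eq_or_ne v 0 with rfl | hv0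
      · simp
      · refine (norm_avgOp_le (exists_le_norm_sub_of_mem_orthogonal hQ π hv hv0) hε).trans ?_
        gcongr
        exact le_max_left _ _
  have : CompleteSpace π.invariants := π.isClosed_invariants.completeSpace_coe
  set p : H := π.invariants.starProjection ξ with hp
  have hpm : p ∈ π.invariants := Submodule.starProjection_apply_mem _ _
  have hq : ξ - p ∈ π.invariantsᗮ := Submodule.sub_starProjection_mem_orthogonal _
  have hξ1 : ‖ξ‖ = 1 := hGNS.norm_eq_one hφ.2
  have hqn : ‖ξ - p‖ ≤ 1 := by
    have := Submodule.norm_sq_eq_add_norm_sq_starProjection ξ π.invariants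
    rw [Submodule.starProjection_orthogonal_val, hξ1] at this
    nlinarith [norm_nonneg (ξ - p), sq_nonneg ‖p‖]
  have hpk : ∀ k : ℕ, (avgOp Q π ^ k) p = p := by
    intro k
    induction k with
    | zero => simp
    | succ k ih => rw [pow_succ, mul_apply_eq_comp, avgOp_of_mem_invariants Q π hpm, ih]
  have hφ' : φ = fun g => inner ℂ ξ ((π g : H →L[ℂ] H) ξ) := funext hξ
  refine ⟨‖p‖ ^ 2, by positivity, fun k g => ?_⟩
  have h1 : ((‖p‖ ^ 2 : ℝ) : ℂ) = inner ℂ ξ ((π g : H →L[ℂ] H) p) := by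
    rw [hpm g, ← sub_add_cancel ξ p, inner_add_left, Submodule.inner_left_of_mem_orthogonal hpm hq,
      zero_add, inner_self_eq_norm_sq_to_K]
    simp
  rw [h1, hφ', avg_pow_coefficient]
  simp only
  rw [← inner_sub_right, ← map_sub]
  have h2 : (avgOp Q π ^ k) ξ - p = (avgOp Q π ^ k) (ξ - p) := by rw [map_sub, hpk]
  refine (norm_inner_le_norm _ _).trans ?_
  rw [hξ1, one_mul, π.norm_apply, h2]
  exact (hgap k _ hq).trans (mul_le_of_le_one_right (by positivity) hqn)

end SpectralGap

/-! ### Null functions -/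

section Null

open Filter Topology

variable {G : Type u} [Group G] {Q : Finset G} {r : ℝ}

/-- The averages of `φ` over the powers of `Q` tend to zero. -/
def Null (Q : Finset G) (φ : G → ℂ) : Prop :=
  Tendsto (fun k => (avg Q ^ k) φ 1) atTop (𝓝 0)

theorem continuous_avg_pow (Q : Finset G) (k : ℕ) : Continuous fun φ : G → ℂ => (avg Q ^ k) φ := by
  have h1 : Continuous fun φ : G → ℂ => avg Q φ := by
    refine continuous_pi fun g => ?_
    simp only [avg_apply]
    fun_prop
  induction k with
  | zero => simpa using continuous_id'
  | succ k ih =>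
    simp only [pow_succ, Module.End.mul_apply]
    exact ih.comp h1

theorem avg_pow_translate (Q : Finset G) (φ : G → ℂ) (a : G) (k : ℕ) :
    (avg Q ^ k) (fun g => φ (a * g)) = fun g => (avg Q ^ k) φ (a * g) := by
  induction k generalizing φ with
  | zero => simp
  | succ k ih =>
    have : avg Q (fun g => φ (a * g)) = fun g => avg Q φ (a * g) := by
      ext g; simp [avg_apply, mul_assoc]
    rw [pow_succ, Module.End.mul_apply, this, ih]
    rfl

theorem avg_pow_one (Q : Finset G) (k : ℕ) : (avg Q ^ k) 1 = 1 := by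
  have h : avg Q (1 : G → ℂ) = 1 := by
    have : (Q.card : ℂ) + 1 ≠ 0 := by norm_cast
    ext g
    simp only [avg_apply, Pi.one_apply, Finset.sum_const, nsmul_eq_mul, mul_one]
    rw [add_comm 1, inv_mul_cancel₀ this]
  induction k with
  | zero => simp
  | succ k ih => rw [pow_succ, Module.End.mul_apply, h, ih]

/-- Averaging has non-negative weights, hence is monotone. The order on ℂ makes the bound also
record that F is real. -/
theorem norm_avg_pow_le (Q : Finset G) {φ F : G → ℂ} (h : ∀ g, (‖φ g‖ : ℂ) ≤ F g) (k : ℕ) (g : G) :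
    (‖(avg Q ^ k) φ g‖ : ℂ) ≤ (avg Q ^ k) F g := by
  induction k generalizing φ F with
  | zero => simpa using h g
  | succ k ih =>
    rw [pow_succ, Module.End.mul_apply, Module.End.mul_apply]
    refine ih fun g => ?_
    have h4 : ‖((Q.card : ℂ) + 1)⁻¹‖ = ((Q.card : ℝ) + 1)⁻¹ := by
      rw [norm_inv]; norm_cast
    have h5 : ‖avg Q φ g‖ ≤ ((Q.card : ℝ) + 1)⁻¹ * (‖φ g‖ + ∑ q ∈ Q, ‖φ (g * q)‖) := by
      rw [avg_apply, norm_mul, h4]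
      gcongr
      exact (norm_add_le _ _).trans (by gcongr; exact norm_sum_le _ _)
    calc (‖avg Q φ g‖ : ℂ) ≤ ((((Q.card : ℝ) + 1)⁻¹ * (‖φ g‖ + ∑ q ∈ Q, ‖φ (g * q)‖) : ℝ) : ℂ) :=
          Complex.real_le_real.2 h5
      _ = ((Q.card : ℂ) + 1)⁻¹ * ((‖φ g‖ : ℂ) + ∑ q ∈ Q, (‖φ (g * q)‖ : ℂ)) := by push_cast; rfl
      _ ≤ avg Q F g := by
          rw [avg_apply]
          refine mul_le_mul_of_nonneg_left (add_le_add (h g) (Finset.sum_le_sum fun q _ => h _)) ?_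
          rw [← Complex.ofReal_natCast, ← Complex.ofReal_one, ← Complex.ofReal_add,
            ← Complex.ofReal_inv]
          exact Complex.zero_le_real.2 (by positivity)

theorem HasGap.tendsto (hQ : HasGap Q r) {φ : G → ℂ} (hφ : φ ∈ PD₁ G) :
    ∃ c : ℝ, 0 ≤ c ∧ ∀ g, Tendsto (fun k => (avg Q ^ k) φ g) atTop (𝓝 (c : ℂ)) := by
  obtain ⟨hr0, hr1, h⟩ := hQ
  obtain ⟨c, hc0, hc⟩ := h φ hφ
  refine ⟨c, hc0, fun g => tendsto_iff_norm_sub_tendsto_zero.2 ?_⟩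
  exact squeeze_zero (fun _ => norm_nonneg _) (fun k => hc k g)
    (tendsto_pow_atTop_nhds_zero_of_lt_one hr0 hr1)

theorem HasGap.tendsto_of_null (hQ : HasGap Q r) {φ : G → ℂ} (hφ : φ ∈ PD₁ G) (h : Null Q φ)
    (g : G) : Tendsto (fun k => (avg Q ^ k) φ g) atTop (𝓝 0) := by
  obtain ⟨c, -, hc⟩ := hQ.tendsto hφ
  have := tendsto_nhds_unique (hc 1) h
  rw [← this]
  exact hc g

/-- Because the rate does not depend on φ, a statement about a limit becomes one closed convex
condition for each k. This lets nullity pass to closed convex hulls within PD₁. -/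
theorem HasGap.null_iff (hQ : HasGap Q r) {φ : G → ℂ} (hφ : φ ∈ PD₁ G) :
    Null Q φ ↔ ∀ k, ‖(avg Q ^ k) φ 1‖ ≤ r ^ k := by
  constructor
  · intro h k
    obtain ⟨c, -, hc⟩ := hQ.2.2 φ hφ
    have hc' : Tendsto (fun k => (avg Q ^ k) φ 1) atTop (𝓝 (c : ℂ)) :=
      tendsto_iff_norm_sub_tendsto_zero.2 (squeeze_zero (fun _ => norm_nonneg _) (fun k => hc k 1)
        (tendsto_pow_atTop_nhds_zero_of_lt_one hQ.1 hQ.2.1))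
    have h0 := tendsto_nhds_unique hc' h
    simpa [h0] using hc k 1
  · intro h
    exact squeeze_zero_norm h (tendsto_pow_atTop_nhds_zero_of_lt_one hQ.1 hQ.2.1)

theorem Null.of_norm_le {φ F : G → ℂ} (hF : Null Q F) (h : ∀ g, (‖φ g‖ : ℂ) ≤ F g) : Null Q φ := by
  refine squeeze_zero_norm (a := fun k => ‖(avg Q ^ k) F 1‖) (fun k => ?_)
    (tendsto_zero_iff_norm_tendsto_zero.1 hF)
  have h1 := norm_avg_pow_le Q h k 1
  exact (Complex.le_def.1 h1).1.trans (Complex.re_le_norm _)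

end Null

/-! ### Indicator functions of subgroups -/

section Indicator

open Filter Topology

variable {G : Type u} [Group G] {Q : Finset G} {r : ℝ}

/-- The indicator function of a subgroup. -/
noncomputable def indicatorFun (K : Subgroup G) : G → ℂ := (K : Set G).indicator 1

open Classical in
theorem indicatorFun_apply (K : Subgroup G) (g : G) :
    indicatorFun K g = if g ∈ K then 1 else 0 := by
  simp [indicatorFun, Set.indicator_apply]

theorem indicatorFun_mem_PD₁ (K : Subgroup G) : indicatorFun K ∈ PD₁ G := by
  classical
  refine ⟨fun n g => ?_, by simp [indicatorFun_apply, K.one_mem]⟩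
  have : (Matrix.of fun i j => indicatorFun K ((g i)⁻¹ * g j)) =
      (1 : Matrix (G ⧸ K) (G ⧸ K) ℂ).submatrix (fun i => (g i : G ⧸ K)) fun i => (g i : G ⧸ K) := by
    ext i j
    simp [indicatorFun_apply, Matrix.one_apply, QuotientGroup.eq]
  rw [this]
  exact Matrix.PosSemidef.one.submatrix _

/-- The averages of the indicator have the same limit c at every point, so each left coset of K
receives mean c. Disjoint cosets have total mean at most 1, which allows at most 1/c of them. -/
theorem HasGap.finiteIndex (hQ : HasGap Q r) {K : Subgroup G} (hK : ¬ Null Q (indicatorFun K)) :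
    K.FiniteIndex := by
  classical
  obtain ⟨c, hc0, hc⟩ := hQ.tendsto (indicatorFun_mem_PD₁ K)
  have hcpos : 0 < c := by
    refine hc0.lt_of_ne fun h => hK ?_
    have := hc 1
    rwa [← h, Complex.ofReal_zero] at this
  by_contra hfin
  have hinf : Infinite (G ⧸ K) := by
    rw [← not_finite_iff_infinite]
    exact fun h => hfin Subgroup.finiteIndex_of_finite_quotient
  obtain ⟨n, hn⟩ := exists_nat_gt c⁻¹
  obtain ⟨s, hs⟩ := Infinite.exists_subset_card_eq (G ⧸ K) n
  have hle : ∀ g : G, (‖∑ a ∈ s, indicatorFun K (a.out⁻¹ * g)‖ : ℂ) ≤ (1 : G → ℂ) g := by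
    intro g
    have : ∑ a ∈ s, indicatorFun K (a.out⁻¹ * g) = ∑ a ∈ s, if a = (g : G ⧸ K) then 1 else 0 := by
      refine Finset.sum_congr rfl fun a _ => ?_
      simp only [indicatorFun_apply, ← QuotientGroup.eq, QuotientGroup.out_eq']
    rw [this, Finset.sum_ite_eq']
    split_ifs <;> simp
  have hk : ∀ k, ‖∑ a ∈ s, (avg Q ^ k) (indicatorFun K) a.out⁻¹‖ ≤ 1 := by
    intro k
    have h1 := norm_avg_pow_le Q hle k 1
    have h2 : (fun g => ∑ a ∈ s, indicatorFun K (a.out⁻¹ * g)) =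
        ∑ a ∈ s, fun g => indicatorFun K (a.out⁻¹ * g) := by ext g; simp
    rw [h2, map_sum, avg_pow_one, Finset.sum_apply] at h1
    simp only [avg_pow_translate, mul_one, Pi.one_apply] at h1
    exact_mod_cast h1
  have hlim : Tendsto (fun k => ‖∑ a ∈ s, (avg Q ^ k) (indicatorFun K) a.out⁻¹‖) atTop
      (𝓝 ‖∑ a ∈ s, (c : ℂ)‖) := (tendsto_finsetSum _ fun a _ => hc _).norm
  have := le_of_tendsto' hlim hk
  simp only [Finset.sum_const, hs, nsmul_eq_mul, norm_mul, Complex.norm_natCast, Complex.norm_real,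
    Real.norm_of_nonneg hc0] at this
  have h3 : 1 < n * c := by rwa [inv_lt_iff_one_lt_mul₀ hcpos] at hn
  linarith

/-- The indicator of the subgroup generated by Q is fixed by averaging, while the limit of the
averages is constant on the group. -/
theorem HasGap.closure_eq_top (hQ : HasGap Q r) : Subgroup.closure (Q : Set G) = ⊤ := by
  classical
  set K := Subgroup.closure (Q : Set G) with hK
  obtain ⟨c, -, hc⟩ := hQ.tendsto (indicatorFun_mem_PD₁ K)
  have h1 : avg Q (indicatorFun K) = indicatorFun K := by
    ext g
    have h2 : ∀ q ∈ Q, indicatorFun K (g * q) = indicatorFun K g := fun q hq => by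
      simp only [indicatorFun_apply, K.mul_mem_cancel_right (Subgroup.subset_closure hq)]
    have h3 : (Q.card : ℂ) + 1 ≠ 0 := by norm_cast
    rw [avg_apply, Finset.sum_congr rfl h2, Finset.sum_const, nsmul_eq_mul]
    field_simp
    ring
  have h2 : ∀ k, (avg Q ^ k) (indicatorFun K) = indicatorFun K := by
    intro k
    induction k with
    | zero => simp
    | succ k ih => rw [pow_succ, Module.End.mul_apply, h1, ih]
  simp only [h2, tendsto_const_nhds_iff] at hc
  rw [Subgroup.eq_top_iff']
  intro g
  have h3 := (hc g).trans (hc 1).symm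
  by_contra hg
  simp [indicatorFun_apply, hg, K.one_mem] at h3

/-- Finite-index subgroups of a finitely generated group are finitely generated, and a countable
group has countably many finite subsets. -/
theorem countable_finiteIndex [Countable G] (hG : Group.FG G) :
    {K : Subgroup G | K.FiniteIndex}.Countable := by
  have : {K : Subgroup G | K.FiniteIndex} ⊆
      Set.range fun s : Finset G => Subgroup.closure (s : Set G) := by
    intro K hK
    have : K.FiniteIndex := hK
    have hfg : K.FG := (Group.fg_iff_subgroup_fg K).1 inferInstance
    exact hfg
  exact (Set.countable_range _).mono this

end Indicator

/-! ### The face of traces that are null against every positive-definite function -/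

section MixingTraces

open Filter Topology

variable {G : Type u} [Group G] {Q : Finset G} {r : ℝ}

theorem isClosed_PD₁ : IsClosed (PD₁ G) := by
  have h1 : PD₁ G = (⋂ (n : ℕ) (g : Fin n → G),
      {φ : G → ℂ | (Matrix.of fun i j => φ ((g i)⁻¹ * g j)).PosSemidef}) ∩ {φ | φ 1 = 1} := by
    ext φ
    simp [PD₁, IsPositiveDefinite]
  rw [h1]
  refine (isClosed_iInter fun n => isClosed_iInter fun g => ?_).inter
    (isClosed_eq (continuous_apply _) continuous_const)
  simp only [Matrix.posSemidef_iff_dotProduct_mulVec, Matrix.IsHermitian, Set.ofPred_and,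
    Set.ofPred_forall]
  refine IsClosed.inter (isClosed_eq ?_ ?_) (isClosed_iInter fun x => isClosed_le ?_ ?_)
  · fun_prop
  · fun_prop
  · fun_prop
  · simp only [dotProduct, Matrix.mulVec, Matrix.of_apply]
    fun_prop

theorem isCompact_PD₁ : IsCompact (PD₁ G) := by
  refine IsCompact.of_isClosed_subset
    (isCompact_univ_pi fun _ : G => isCompact_closedBall (0 : ℂ) 1) isClosed_PD₁ ?_
  intro φ hφ g _
  simpa using norm_le_one_of_mem_PD₁ hφ g

theorem convex_PD₁ : Convex ℝ (PD₁ G) := by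
  intro φ hφ ψ hψ a b ha hb hab
  refine ⟨fun n g => ?_, ?_⟩
  · have := ((hφ.1 n g).smul (Complex.zero_le_real.2 ha)).add
      ((hψ.1 n g).smul (Complex.zero_le_real.2 hb))
    convert this using 1
    ext i j
    simp
  · simp only [Pi.add_apply, Pi.smul_apply, hφ.2, hψ.2, Complex.real_smul, mul_one]
    exact_mod_cast hab

theorem isClosed_traces : IsClosed (traces G) := by
  have : traces G = PD₁ G ∩ ⋂ g, {φ | conjFun g φ = φ} := by ext φ; simp [traces]
  rw [this]
  refine isClosed_PD₁.inter (isClosed_iInter fun g => isClosed_eq ?_ continuous_id)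
  exact continuous_pi fun x => continuous_apply _

theorem convex_traces : Convex ℝ (traces G) := by
  intro φ hφ ψ hψ a b ha hb hab
  refine ⟨convex_PD₁ hφ.1 hψ.1 ha hb hab, fun g => ?_⟩
  ext x
  have h1 := congrFun (hφ.2 g) x
  have h2 := congrFun (hψ.2 g) x
  simp only [conjFun] at h1 h2
  simp [conjFun, h1, h2]

/-- The traces whose product with every normalized positive-definite function is null. -/
def mixingTraces (Q : Finset G) : Set (G → ℂ) :=
  {τ | τ ∈ traces G ∧ ∀ ψ ∈ PD₁ G, Null Q (τ * ψ)}

theorem avg_pow_combo (Q : Finset G) (k : ℕ) (a b : ℝ) (φ₁ φ₂ ψ : G → ℂ) :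
    (avg Q ^ k) ((a • φ₁ + b • φ₂) * ψ) 1 =
      a * (avg Q ^ k) (φ₁ * ψ) 1 + b * (avg Q ^ k) (φ₂ * ψ) 1 := by
  have : (a • φ₁ + b • φ₂) * ψ = (a : ℂ) • (φ₁ * ψ) + (b : ℂ) • (φ₂ * ψ) := by
    ext g; simp; ring
  rw [this, map_add, map_smul, map_smul]
  rfl

theorem HasGap.isClosed_mixingTraces (hQ : HasGap Q r) : IsClosed (mixingTraces Q) := by
  have : mixingTraces Q = traces G ∩ {τ | ∀ ψ ∈ PD₁ G, ∀ k, ‖(avg Q ^ k) (τ * ψ) 1‖ ≤ r ^ k} := by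
    ext τ
    refine and_congr_right fun hτ => forall₂_congr fun ψ hψ => ?_
    exact hQ.null_iff (mul_mem_PD₁ hτ.1 hψ)
  rw [this]
  simp only [Set.ofPred_forall]
  refine isClosed_traces.inter (isClosed_iInter fun ψ => isClosed_iInter fun _ =>
    isClosed_iInter fun k => isClosed_le ?_ continuous_const)
  have h1 := (continuous_apply (1 : G)).comp ((continuous_avg_pow Q k).comp
    (continuous_id.mul (continuous_const (y := ψ))))
  exact h1.norm

theorem convex_mixingTraces (Q : Finset G) : Convex ℝ (mixingTraces Q) := by
  intro φ₁ h₁ φ₂ h₂ a b ha hb hab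
  refine ⟨convex_traces h₁.1 h₂.1 ha hb hab, fun ψ hψ => ?_⟩
  have := ((h₁.2 ψ hψ).const_mul (a : ℂ)).add ((h₂.2 ψ hψ).const_mul (b : ℂ))
  simp only [mul_zero, add_zero] at this
  exact this.congr fun k => (avg_pow_combo Q k a b φ₁ φ₂ ψ).symm

/-- Limits of averages are non-negative and depend affinely on the trace, so a proper convex
combination has limit 0 only if both terms do. -/
theorem HasGap.isExtreme_mixingTraces (hQ : HasGap Q r) :
    IsExtreme ℝ (traces G) (mixingTraces Q) := by
  refine ⟨fun τ hτ => hτ.1, ?_⟩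
  rintro φ₁ h₁ φ₂ h₂ φ hφ ⟨a, b, ha, hb, hab, rfl⟩
  refine ⟨h₁, fun ψ hψ => ?_⟩
  obtain ⟨c₁, hc₁, hl₁⟩ := hQ.tendsto (mul_mem_PD₁ h₁.1 hψ)
  obtain ⟨c₂, hc₂, hl₂⟩ := hQ.tendsto (mul_mem_PD₁ h₂.1 hψ)
  have h := ((hl₁ 1).const_mul (a : ℂ)).add ((hl₂ 1).const_mul (b : ℂ))
  have h0 := tendsto_nhds_unique
    (h.congr fun k => (avg_pow_combo Q k a b φ₁ φ₂ ψ).symm) (hφ.2 ψ hψ)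
  have h3 : a * c₁ + b * c₂ = 0 := by exact_mod_cast h0
  have h4 : c₁ = 0 := by
    have := mul_nonneg ha.le hc₁
    have := mul_nonneg hb.le hc₂
    have h5 : a * c₁ = 0 := by linarith
    exact (mul_eq_zero.1 h5).resolve_left ha.ne'
  have := hl₁ 1
  rwa [h4, Complex.ofReal_zero] at this

/-- Krein–Milman inside the closed face: its extreme points are characters, and testing membership
against ψ = χ̄ excludes the second alternative of `hchar`. Vanishing at g is closed and convex. -/
theorem HasGap.eq_zero_of_mem_mixingTraces (hQ : HasGap Q r) {S : Set G}
    (hchar : ∀ χ ∈ characters G, (∀ g ∉ S, χ g = 0) ∨ ¬ Null Q (χ * star χ))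
    {τ : G → ℂ} (hτ : τ ∈ mixingTraces Q) {g : G} (hg : g ∉ S) : τ g = 0 := by
  have hcomp : IsCompact (mixingTraces Q) :=
    isCompact_PD₁.of_isClosed_subset hQ.isClosed_mixingTraces fun τ hτ => hτ.1.1
  rw [← closure_convexHull_extremePoints hcomp (convex_mixingTraces Q)] at hτ
  have hsub : closure (convexHull ℝ ((mixingTraces Q).extremePoints ℝ)) ⊆ {φ | φ g = 0} := by
    refine closure_minimal (convexHull_min ?_ ?_) (isClosed_eq (continuous_apply g) continuous_const)
    · intro χ hχ
      refine (hchar χ (hQ.isExtreme_mixingTraces.extremePoints_subset_extremePoints hχ)).elim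
        (fun h => h g hg) fun h => absurd (hχ.1.2 _ (star_mem_PD₁ hχ.1.1.1)) h
    · intro φ hφ ψ hψ a b _ _ _
      have h1 : φ g = 0 := hφ
      have h2 : ψ g = 0 := hψ
      simp [h1, h2]
  exact hsub hτ

theorem mem_mixingTraces {τ : G → ℂ} (hτ : τ ∈ traces G)
    (hpos : ∀ g, 0 ≤ τ g) (hnull : Null Q τ) : τ ∈ mixingTraces Q := by
  refine ⟨hτ, fun ψ hψ => hnull.of_norm_le fun g => ?_⟩
  have h1 := norm_le_one_of_mem_PD₁ hψ g
  rw [Pi.mul_apply, norm_mul]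
  calc ((‖τ g‖ * ‖ψ g‖ : ℝ) : ℂ) ≤ (‖τ g‖ : ℝ) :=
        Complex.real_le_real.2 (mul_le_of_le_one_right (norm_nonneg _) h1)
    _ = τ g := (Complex.eq_coe_norm_of_nonneg (hpos g)).symm

end MixingTraces

/-! ### Finite rank operators and the Powers–Størmer inequality -/

section PowersStormer

open scoped InnerProductSpace

variable {E : Type*} [NormedAddCommGroup E] [InnerProductSpace ℂ E] {ι : Type*} [Fintype ι]

/-- The positive operator `∑ⱼ cⱼ |eⱼ⟩⟨eⱼ|`. -/
noncomputable def diagOp (c : ι → ℝ) (e : ι → E) : E →L[ℂ] E :=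
  ∑ j, (c j : ℂ) • (innerSL ℂ (e j)).smulRight (e j)

theorem diagOp_apply (c : ι → ℝ) (e : ι → E) (w : E) :
    diagOp c e w = ∑ j, ((c j : ℂ) * ⟪e j, w⟫_ℂ) • e j := by
  simp [diagOp, mul_smul]

theorem inner_diagOp (c : ι → ℝ) (e : ι → E) (v w : E) :
    ⟪v, diagOp c e w⟫_ℂ = ∑ j, (c j : ℂ) * (⟪v, e j⟫_ℂ * ⟪e j, w⟫_ℂ) := by
  simp only [diagOp_apply, inner_sum, inner_smul_right]
  exact Finset.sum_congr rfl fun j _ => by ring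

theorem inner_mul_inner_self (v w : E) : ⟪v, w⟫_ℂ * ⟪w, v⟫_ℂ = ((‖⟪v, w⟫_ℂ‖ ^ 2 : ℝ) : ℂ) := by
  rw [← inner_conj_symm w v, Complex.mul_conj, Complex.normSq_eq_norm_sq]

theorem inner_diagOp_self (c : ι → ℝ) (e : ι → E) (v : E) :
    ⟪v, diagOp c e v⟫_ℂ = ((∑ j, c j * ‖⟪v, e j⟫_ℂ‖ ^ 2 : ℝ) : ℂ) := by
  rw [inner_diagOp]
  simp only [inner_mul_inner_self]
  push_cast
  rfl

theorem isSymmetric_diagOp (c : ι → ℝ) (e : ι → E) :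
    (diagOp c e : E →ₗ[ℂ] E).IsSymmetric := by
  intro v w
  simp only [ContinuousLinearMap.coe_coe]
  rw [inner_diagOp, ← inner_conj_symm, inner_diagOp, map_sum]
  refine Finset.sum_congr rfl fun j _ => ?_
  simp only [map_mul, inner_conj_symm, Complex.conj_ofReal]
  ring

theorem inner_diagOp_diagOp {e f : ι → E} (a b : ι → ℝ) (v w : E) :
    ⟪diagOp a e v, diagOp b f w⟫_ℂ =
      ∑ i, ∑ j, (a i * b j : ℂ) * (⟪e i, f j⟫_ℂ * (⟪v, e i⟫_ℂ * ⟪f j, w⟫_ℂ)) := by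
  simp only [diagOp_apply, sum_inner, inner_sum, inner_smul_left, inner_smul_right, map_mul,
    inner_conj_symm, Complex.conj_ofReal, Finset.mul_sum]
  rw [Finset.sum_comm]
  exact Finset.sum_congr rfl fun i _ => Finset.sum_congr rfl fun j _ => by ring

theorem norm_sq_diagOp {e : ι → E} (he : Orthonormal ℂ e) (a : ι → ℝ) (v : E) :
    ‖diagOp a e v‖ ^ 2 = ∑ j, a j ^ 2 * ‖⟪v, e j⟫_ℂ‖ ^ 2 := by
  classical
  have h : ⟪diagOp a e v, diagOp a e v⟫_ℂ = ((∑ j, a j ^ 2 * ‖⟪v, e j⟫_ℂ‖ ^ 2 : ℝ) : ℂ) := by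
    rw [inner_diagOp_diagOp]
    simp only [orthonormal_iff_ite.1 he, ite_mul, one_mul, zero_mul, mul_ite, mul_zero,
      Finset.sum_ite_eq, Finset.mem_univ, if_true, inner_mul_inner_self]
    push_cast
    exact Finset.sum_congr rfl fun i _ => by ring
  rw [inner_self_eq_norm_sq_to_K] at h
  have h2 : ((‖diagOp a e v‖ ^ 2 : ℝ) : ℂ) = ((∑ j, a j ^ 2 * ‖⟪v, e j⟫_ℂ‖ ^ 2 : ℝ) : ℂ) := by
    rw [← h]; push_cast; rfl
  exact_mod_cast h2

/-- The Powers–Størmer inequality in finite dimension. -/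
theorem powers_stormer_of_finiteDimensional [FiniteDimensional ℂ E] {e f : ι → E}
    (he : Orthonormal ℂ e) (hf : Orthonormal ℂ f) {a : ι → ℝ} (ha : ∀ j, 0 ≤ a j) {δ : ℝ}
    (h : ∀ x : E →L[ℂ] E, ‖x‖ ≤ 1 →
      ‖∑ j, (a j : ℂ) ^ 2 * (⟪e j, x (e j)⟫_ℂ - ⟪f j, x (f j)⟫_ℂ)‖ ≤ δ) :
    2 * ∑ j, a j ^ 2 - 2 * ∑ i, ∑ j, a i * a j * ‖⟪e i, f j⟫_ℂ‖ ^ 2 ≤ δ := by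
  have hsym : (diagOp a e - diagOp a f : E →ₗ[ℂ] E).IsSymmetric :=
    (isSymmetric_diagOp a e).sub (isSymmetric_diagOp a f)
  set b := hsym.eigenvectorBasis rfl with hb
  set μ := hsym.eigenvalues rfl with hμ
  have hbμ : ∀ k, diagOp a e (b k) - diagOp a f (b k) = (μ k : ℂ) • b k :=
    fun k => hsym.apply_eigenvectorBasis rfl k
  -- The test operator is the sign of S - T, where S and T are the diagonal operators along e and f.
  -- Taking the value 1 at eigenvalue 0 makes every σ k equal to ±1, so the operator is isometric.
  set σ : Fin (Module.finrank ℂ E) → ℝ := fun k => if 0 ≤ μ k then 1 else -1 with hσ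
  have hσ1 : ∀ k, |σ k| = 1 := fun k => by simp only [hσ]; split_ifs <;> simp
  have hσμ : ∀ k, σ k * μ k = |μ k| := fun k => by
    simp only [hσ]
    split_ifs with h0
    · rw [one_mul, abs_of_nonneg h0]
    · rw [abs_of_neg (not_le.1 h0)]; ring
  have hx : ‖diagOp σ b‖ ≤ 1 := by
    refine ContinuousLinearMap.opNorm_le_bound _ zero_le_one fun v => ?_
    have h1 : ‖diagOp σ b v‖ ^ 2 = ‖v‖ ^ 2 := by
      rw [norm_sq_diagOp b.orthonormal, ← b.sum_sq_norm_inner_left v]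
      refine Finset.sum_congr rfl fun k _ => ?_
      rw [← sq_abs (σ k), hσ1, one_pow, one_mul]
    rw [one_mul]
    exact (sq_le_sq₀ (norm_nonneg _) (norm_nonneg _)).1 h1.le
  have hsum : ∀ {g : ι → E}, Orthonormal ℂ g →
      ∑ j, (a j : ℂ) ^ 2 * ⟪g j, diagOp σ b (g j)⟫_ℂ =
        ((∑ k, σ k * ‖diagOp a g (b k)‖ ^ 2 : ℝ) : ℂ) := by
    intro g hg
    simp only [inner_diagOp_self, norm_sq_diagOp hg, Finset.mul_sum]
    rw [Finset.sum_comm]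
    push_cast
    simp only [Finset.mul_sum]
    refine Finset.sum_congr rfl fun j _ => Finset.sum_congr rfl fun k _ => ?_
    rw [norm_inner_symm]
    ring
  have hre : ∀ {g : ι → E} (k), ⟪b k, diagOp a g (b k)⟫_ℂ =
      ((∑ j, a j * ‖⟪b k, g j⟫_ℂ‖ ^ 2 : ℝ) : ℂ) := fun {g} k => inner_diagOp_self a g (b k)
  -- On an eigenvector of S - T, ‖Sb‖² - ‖Tb‖² = Re⟨(S - T)b, (S + T)b⟩ = μ(α + β). Moreover |μ| =
  -- |α - β| ≤ α + β by positivity of S and T.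
  have hkey : ∀ k, μ k ^ 2 ≤ σ k * ‖diagOp a e (b k)‖ ^ 2 - σ k * ‖diagOp a f (b k)‖ ^ 2 := by
    intro k
    set α := ∑ j, a j * ‖⟪b k, e j⟫_ℂ‖ ^ 2 with hα
    set β := ∑ j, a j * ‖⟪b k, f j⟫_ℂ‖ ^ 2 with hβ
    have hα0 : 0 ≤ α := Finset.sum_nonneg fun j _ => mul_nonneg (ha j) (by positivity)
    have hβ0 : 0 ≤ β := Finset.sum_nonneg fun j _ => mul_nonneg (ha j) (by positivity)
    have h1 : μ k = α - β := by
      have h2 : ⟪b k, diagOp a e (b k) - diagOp a f (b k)⟫_ℂ = (μ k : ℂ) := by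
        rw [hbμ, inner_smul_right, inner_self_eq_norm_sq_to_K, b.norm_eq_one]
        simp
      rw [inner_sub_right, hre, hre] at h2
      exact_mod_cast h2.symm
    have h2 : ‖diagOp a e (b k)‖ ^ 2 - ‖diagOp a f (b k)‖ ^ 2 = μ k * (α + β) := by
      have h3 : ⟪diagOp a e (b k) - diagOp a f (b k), diagOp a e (b k) + diagOp a f (b k)⟫_ℂ =
          ((μ k * (α + β) : ℝ) : ℂ) := by
        rw [hbμ, inner_smul_left, inner_add_right, hre, hre, Complex.conj_ofReal, hα, hβ]
        push_cast
        rfl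
      have h4 := congrArg Complex.re h3
      rw [Complex.ofReal_re, inner_sub_left, inner_add_right, inner_add_right] at h4
      have h5 := inner_re_symm (𝕜 := ℂ) (diagOp a e (b k)) (diagOp a f (b k))
      have h6 := inner_self_eq_norm_sq (𝕜 := ℂ) (diagOp a e (b k))
      have h7 := inner_self_eq_norm_sq (𝕜 := ℂ) (diagOp a f (b k))
      simp only [RCLike.re_to_complex] at h5 h6 h7
      simp only [Complex.sub_re, Complex.add_re] at h4
      linarith
    rw [← mul_sub, h2, ← mul_assoc, hσμ, ← sq_abs, sq]
    refine mul_le_mul_of_nonneg_left ?_ (abs_nonneg _)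
    rw [h1]
    exact abs_le.2 ⟨by linarith, by linarith⟩
  have hle : ∑ k, μ k ^ 2 ≤ δ := by
    refine (Finset.sum_le_sum fun k _ => hkey k).trans ?_
    have h1 := h (diagOp σ b) hx
    simp only [mul_sub, Finset.sum_sub_distrib] at h1
    rw [hsum he, hsum hf, ← Complex.ofReal_sub, Complex.norm_real] at h1
    rw [Finset.sum_sub_distrib]
    exact (le_abs_self _).trans h1
  have htr : ∀ {g : ι → E}, Orthonormal ℂ g → ∑ k, ‖diagOp a g (b k)‖ ^ 2 = ∑ j, a j ^ 2 := by
    intro g hg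
    simp only [norm_sq_diagOp hg]
    rw [Finset.sum_comm]
    refine Finset.sum_congr rfl fun j _ => ?_
    rw [← Finset.mul_sum, b.sum_sq_norm_inner_right, hg.1 j]
    simp
  have hcross : ∑ k, (⟪diagOp a e (b k), diagOp a f (b k)⟫_ℂ).re =
      ∑ i, ∑ j, a i * a j * ‖⟪e i, f j⟫_ℂ‖ ^ 2 := by
    have h1 : ∑ k, ⟪diagOp a e (b k), diagOp a f (b k)⟫_ℂ =
        ((∑ i, ∑ j, a i * a j * ‖⟪e i, f j⟫_ℂ‖ ^ 2 : ℝ) : ℂ) := by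
      simp only [inner_diagOp_diagOp]
      push_cast
      rw [Finset.sum_comm]
      refine Finset.sum_congr rfl fun i _ => ?_
      rw [Finset.sum_comm]
      refine Finset.sum_congr rfl fun j _ => ?_
      simp only [← Finset.mul_sum, mul_comm (⟪b _, e i⟫_ℂ), b.sum_inner_mul_inner]
      rw [inner_mul_inner_self]
      push_cast
      ring
    have := congrArg Complex.re h1
    rwa [Complex.ofReal_re, Complex.re_sum] at this
  -- The left side is the squared Hilbert–Schmidt norm of S - T, expanded in the eigenbasis b.
  have hexp : ∑ k, μ k ^ 2 = 2 * ∑ j, a j ^ 2 - 2 * ∑ i, ∑ j, a i * a j * ‖⟪e i, f j⟫_ℂ‖ ^ 2 := by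
    have h1 : ∀ k, μ k ^ 2 = ‖diagOp a e (b k)‖ ^ 2 + ‖diagOp a f (b k)‖ ^ 2 -
        2 * (⟪diagOp a e (b k), diagOp a f (b k)⟫_ℂ).re := by
      intro k
      have h2 : ‖diagOp a e (b k) - diagOp a f (b k)‖ ^ 2 = μ k ^ 2 := by
        rw [hbμ, norm_smul, b.norm_eq_one, mul_one, Complex.norm_real, Real.norm_eq_abs, sq_abs]
      rw [← h2, @norm_sub_sq ℂ]
      simp only [RCLike.re_to_complex]
      ring
    simp only [h1, Finset.sum_sub_distrib, Finset.sum_add_distrib, ← Finset.mul_sum, hcross,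
      htr he, htr hf]
    ring
  linarith

/-- The Powers–Størmer inequality for finite rank operators with equal spectra. -/
theorem powers_stormer {e f : ι → E}
    (he : Orthonormal ℂ e) (hf : Orthonormal ℂ f) {a : ι → ℝ} (ha : ∀ j, 0 ≤ a j) {δ : ℝ}
    (h : ∀ x : E →L[ℂ] E, ‖x‖ ≤ 1 →
      ‖∑ j, (a j : ℂ) ^ 2 * (⟪e j, x (e j)⟫_ℂ - ⟪f j, x (f j)⟫_ℂ)‖ ≤ δ) :
    2 * ∑ j, a j ^ 2 - 2 * ∑ i, ∑ j, a i * a j * ‖⟪e i, f j⟫_ℂ‖ ^ 2 ≤ δ := by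
  -- Everything lives on the span of both families. Test operators on W extend to E through the
  -- orthogonal projection, with norm still at most 1.
  let W : Submodule ℂ E := Submodule.span ℂ (Set.range e ∪ Set.range f)
  have : FiniteDimensional ℂ W :=
    FiniteDimensional.span_of_finite ℂ ((Set.finite_range e).union (Set.finite_range f))
  let e' : ι → W := fun j => ⟨e j, Submodule.subset_span (Or.inl ⟨j, rfl⟩)⟩
  let f' : ι → W := fun j => ⟨f j, Submodule.subset_span (Or.inr ⟨j, rfl⟩)⟩
  have he' : Orthonormal ℂ e' := he.codRestrict W fun j => (e' j).2
  have hf' : Orthonormal ℂ f' := hf.codRestrict W fun j => (f' j).2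
  refine powers_stormer_of_finiteDimensional he' hf' ha fun x hx => ?_
  have hn : ‖W.subtypeL ∘L x ∘L W.orthogonalProjectionOnto‖ ≤ 1 := by
    refine ContinuousLinearMap.opNorm_le_bound _ zero_le_one fun v => ?_
    rw [one_mul]
    calc ‖x (W.orthogonalProjectionOnto v)‖ ≤ ‖x‖ * ‖W.orthogonalProjectionOnto v‖ := x.le_opNorm _
      _ ≤ 1 * ‖v‖ := by gcongr; exact W.norm_orthogonalProjectionOnto_apply_le v
      _ = ‖v‖ := one_mul _
  have h1 := h _ hn
  have h2 : ∀ w : W, ⟪(w : E), (W.subtypeL ∘L x ∘L W.orthogonalProjectionOnto) (w : E)⟫_ℂ =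
      ⟪w, x w⟫_ℂ := fun w => by simp
  have h3 : ∀ j, e j = (e' j : E) := fun j => rfl
  have h4 : ∀ j, f j = (f' j : E) := fun j => rfl
  simp only [h3, h4, h2] at h1
  exact h1

/-- A finite convex combination of vector states is diagonal in an orthonormal family. -/
theorem exists_orthonormal_diagonalization (t : ι → ℝ) (ht : ∀ i, 0 ≤ t i) (v : ι → E) :
    ∃ (n : ℕ) (e : Fin n → E) (a : Fin n → ℝ), Orthonormal ℂ e ∧ (∀ j, 0 ≤ a j) ∧
      ∀ x : E →L[ℂ] E, ∑ i, (t i : ℂ) * ⟪v i, x (v i)⟫_ℂ =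
        ∑ j, (a j : ℂ) ^ 2 * ⟪e j, x (e j)⟫_ℂ := by
  let W : Submodule ℂ E := Submodule.span ℂ (Set.range v)
  have : FiniteDimensional ℂ W := FiniteDimensional.span_of_finite ℂ (Set.finite_range v)
  let v' : ι → W := fun j => ⟨v j, Submodule.subset_span ⟨j, rfl⟩⟩
  have hsym := isSymmetric_diagOp t v'
  set b := hsym.eigenvectorBasis rfl with hb
  set μ := hsym.eigenvalues rfl with hμ
  have hbμ : ∀ k, diagOp t v' (b k) = (μ k : ℂ) • b k := fun k =>
    hsym.apply_eigenvectorBasis rfl k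
  have hinner : ∀ k l, ⟪b l, diagOp t v' (b k)⟫_ℂ = if l = k then (μ k : ℂ) else 0 := fun k l => by
    rw [hbμ, inner_smul_right, orthonormal_iff_ite.1 b.orthonormal]
    simp
  have hμ0 : ∀ k, 0 ≤ μ k := fun k => by
    have h1 := hinner k k
    rw [inner_diagOp_self, if_pos rfl] at h1
    have h2 : ∑ j, t j * ‖⟪b k, v' j⟫_ℂ‖ ^ 2 = μ k := by exact_mod_cast h1
    rw [← h2]
    exact Finset.sum_nonneg fun j _ => mul_nonneg (ht j) (by positivity)
  -- The coefficients are square roots of the eigenvalues of the density, since Powers–Størmer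
  -- compares square roots of densities.
  refine ⟨_, fun k => (b k : E), fun k => √(μ k), b.orthonormal.comp_linearIsometry W.subtypeₗᵢ,
    fun k => Real.sqrt_nonneg _, fun x => ?_⟩
  have hv : ∀ i, v i = ∑ k, ⟪b k, v' i⟫_ℂ • (b k : E) := fun i => by
    have := congrArg (Subtype.val) (b.sum_repr' (v' i))
    rw [← show (v' i : E) = v i from rfl, ← this]
    simp
  have h1 : ∀ i, (t i : ℂ) * ⟪v i, x (v i)⟫_ℂ = ∑ k, ∑ l,
      (t i : ℂ) * (⟪b l, v' i⟫_ℂ * ⟪v' i, b k⟫_ℂ) * ⟪(b k : E), x (b l)⟫_ℂ := by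
    intro i
    conv_lhs => rw [hv i]
    simp only [map_sum, map_smul, sum_inner, inner_sum, inner_smul_left, inner_smul_right,
      inner_conj_symm, Finset.mul_sum]
    rw [Finset.sum_comm]
    exact Finset.sum_congr rfl fun k _ => Finset.sum_congr rfl fun l _ => by ring
  simp only [h1]
  rw [Finset.sum_comm]
  refine Finset.sum_congr rfl fun k _ => ?_
  rw [Finset.sum_comm]
  simp only [← Finset.sum_mul, ← inner_diagOp, hinner, ite_mul, zero_mul, Finset.sum_ite_eq',
    Finset.mem_univ, if_true]
  rw [← Complex.ofReal_pow, Real.sq_sqrt (hμ0 k)]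

end PowersStormer

/-! ### Invariant states and almost invariant vector states -/

section InvariantState

open scoped InnerProductSpace

variable {H : Type u} [NormedAddCommGroup H] [InnerProductSpace ℂ H]

/-- The functional `x ↦ ⟨v, x w⟩` on `B(H)`. -/
noncomputable def vectorFunctional (v w : H) : (H →L[ℂ] H) →L[ℂ] ℂ :=
  innerSL ℂ v ∘L ContinuousLinearMap.apply ℂ H w

@[simp]
theorem vectorFunctional_apply (v w : H) (x : H →L[ℂ] H) :
    vectorFunctional v w x = ⟪v, x w⟫_ℂ := by
  simp [vectorFunctional]

theorem norm_vectorFunctional_le (v w : H) : ‖vectorFunctional v w‖ ≤ ‖v‖ * ‖w‖ := by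
  refine ContinuousLinearMap.opNorm_le_bound _ (by positivity) fun x => ?_
  rw [vectorFunctional_apply]
  calc ‖⟪v, x w⟫_ℂ‖ ≤ ‖v‖ * ‖x w‖ := norm_inner_le_norm _ _
    _ ≤ ‖v‖ * (‖x‖ * ‖w‖) := by gcongr; exact x.le_opNorm w
    _ = _ := by ring

variable [CompleteSpace H]

/-- Functionals on the dual of `B(H)` restrict to bounded operators on the vector functionals. -/
theorem exists_operator_of_functional (L : ((H →L[ℂ] H) →L[ℂ] ℂ) →L[ℂ] ℂ) :
    ∃ x : H →L[ℂ] H, ∀ v w, L (vectorFunctional v w) = ⟪v, x w⟫_ℂ := by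
  let B₀ : H →ₗ⋆[ℂ] H →ₗ[ℂ] ℂ := LinearMap.mk₂'ₛₗ (starRingEnd ℂ) (RingHom.id ℂ)
    (fun v w => L (vectorFunctional v w))
    (fun v v' w => by
      rw [← map_add]; congr 1; ext x; simp)
    (fun c v w => by
      rw [← map_smul]; congr 1; ext x; simp [mul_comm])
    (fun v w w' => by
      rw [← map_add]; congr 1; ext x; simp)
    (fun c v w => by
      rw [← map_smul]; congr 1; ext x; simp)
  let B : H →L⋆[ℂ] H →L[ℂ] ℂ := B₀.mkContinuous₂ ‖L‖ fun v w =>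
    (L.le_opNorm _).trans (by
      rw [mul_assoc]; gcongr; exact norm_vectorFunctional_le v w)
  refine ⟨ContinuousLinearMap.adjoint (InnerProductSpace.continuousLinearMapOfBilin B),
    fun v w => ?_⟩
  rw [ContinuousLinearMap.adjoint_inner_right,
    InnerProductSpace.continuousLinearMapOfBilin_apply]
  rfl

variable {G : Type u} [Group G]

/-- Day's convexity argument. If 0 were not in the norm closure of the convex hull of the
displacements of vector states, a separating functional, read on vector functionals as a tuple of
operators x_q, would give A = ∑ (x_q - π(q) x_q π(q)⁻¹) with Re⟨v, Av⟩ ≥ c‖v‖² and c > 0. But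
invariance forces f(A) = 0. Norm closure is what makes the estimate uniform in x. -/
theorem exists_almost_invariant_of_invariant_state (π : UnitaryRep G H) (Q : Finset G)
    (f : (H →L[ℂ] H) →ₗ[ℂ] ℂ) (hpos : ∀ x : H →L[ℂ] H, x.IsPositive → 0 ≤ f x) (h1 : f 1 = 1)
    (hinv : ∀ (g : G) (x : H →L[ℂ] H), f ((π g : H →L[ℂ] H) * x * (π g⁻¹ : H →L[ℂ] H)) = f x)
    {ε : ℝ} (hε : 0 < ε) :
    ∃ (κ : Type) (_ : Fintype κ) (t : κ → ℝ) (v : κ → H), (∀ i, 0 ≤ t i) ∧ ∑ i, t i = 1 ∧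
      (∀ i, ‖v i‖ = 1) ∧ ∀ q ∈ Q, ∀ x : H →L[ℂ] H,
        ‖∑ i, (t i : ℂ) * (⟪v i, x (v i)⟫_ℂ -
          ⟪v i, ((π q : H →L[ℂ] H) * x * (π q⁻¹ : H →L[ℂ] H)) (v i)⟫_ℂ)‖ ≤ ε * ‖x‖ := by
  classical
  let Φ : H → Q → ((H →L[ℂ] H) →L[ℂ] ℂ) := fun v q =>
    vectorFunctional v v -
      vectorFunctional ((π (q : G)⁻¹ : H →L[ℂ] H) v) ((π (q : G)⁻¹ : H →L[ℂ] H) v)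
  have hΦ : ∀ v q x, Φ v q x = ⟪v, x v⟫_ℂ -
      ⟪v, ((π (q : G) : H →L[ℂ] H) * x * (π (q : G)⁻¹ : H →L[ℂ] H)) v⟫_ℂ := by
    intro v q x
    simp only [Φ, sub_apply, vectorFunctional_apply, mul_apply_eq_comp]
    rw [π.inner_apply_right]
  set S : Set (Q → ((H →L[ℂ] H) →L[ℂ] ℂ)) := Φ '' {v | ‖v‖ = 1} with hS
  have h0 : (0 : Q → ((H →L[ℂ] H) →L[ℂ] ℂ)) ∈ closure (convexHull ℝ S) := by
    by_contra hcon
    obtain ⟨L, c, hc, hL⟩ := RCLike.geometric_hahn_banach_point_closed (𝕜 := ℂ)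
      (convex_convexHull ℝ S).closure isClosed_closure hcon
    rw [map_zero] at hc
    have hc : 0 < c := by simpa using hc
    choose x hx using fun q : Q => exists_operator_of_functional
      (L ∘L ContinuousLinearMap.single ℂ (fun _ : Q => (H →L[ℂ] H) →L[ℂ] ℂ) q)
    set A : (Q → (H →L[ℂ] H)) → (H →L[ℂ] H) := fun x => ∑ q : Q,
      (x q - (π (q : G) : H →L[ℂ] H) * x q * (π (q : G)⁻¹ : H →L[ℂ] H)) with hA
    have hfA : ∀ x, f (A x) = 0 := fun x => by
      simp only [hA, map_sum, map_sub, hinv, sub_self, Finset.sum_const_zero]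
    -- The adjoint of A has the same shape, so f kills it too. Positivity can then be applied to A +
    -- A* - 2c.
    have hstarA : star (A x) = A (fun q => star (x q)) := by
      simp only [hA, star_sum, star_sub, star_mul, π.star_apply, inv_inv, mul_assoc]
    have hLA : ∀ v, L (Φ v) = ⟪v, A x v⟫_ℂ := by
      intro v
      have h2 : Φ v = ∑ q : Q, Pi.single q (Φ v q) := (Finset.univ_sum_single _).symm
      rw [h2, map_sum]
      simp only [hA, sum_apply, inner_sum]
      refine Finset.sum_congr rfl fun q _ => ?_
      have h3 := fun v w => hx q v w
      simp only [ContinuousLinearMap.comp_apply, ContinuousLinearMap.single_apply] at h3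
      simp only [Φ, Pi.single_sub, map_sub, h3, sub_apply, inner_sub_right, mul_apply_eq_comp]
      rw [π.inner_apply_right (q : G)]
    have hlow : ∀ v : H, c * ‖v‖ ^ 2 ≤ (⟪v, A x v⟫_ℂ).re := by
      intro v
      rcases eq_or_ne v 0 with rfl | hv
      · simp
      · have hn : ‖v‖ ≠ 0 := norm_ne_zero_iff.2 hv
        have h4 := hL (Φ ((‖v‖⁻¹ : ℂ) • v)) (subset_closure (subset_convexHull ℝ S
          ⟨_, by simp [norm_smul, hn], rfl⟩))
        rw [hLA, map_smul, inner_smul_left, inner_smul_right] at h4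
        have h5 : (starRingEnd ℂ) (‖v‖⁻¹ : ℂ) * ((‖v‖⁻¹ : ℂ) * ⟪v, A x v⟫_ℂ) =
            ((‖v‖⁻¹ ^ 2 : ℝ) : ℂ) * ⟪v, A x v⟫_ℂ := by
          simp; ring
        rw [h5] at h4
        simp only [RCLike.re_to_complex, Complex.re_ofReal_mul] at h4
        rw [inv_pow, inv_mul_eq_div, lt_div_iff₀ (by positivity)] at h4
        exact h4.le
    have hP : (A x + star (A x) - ((2 * c : ℝ) : ℂ) • 1).IsPositive := by
      refine (ContinuousLinearMap.isPositive_iff' _).2 ⟨?_, fun v => ?_⟩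
      · rw [IsSelfAdjoint, star_sub, star_add, star_star, star_smul, star_one, add_comm (star _)]
        simp
      · have h6 : ⟪(A x + star (A x) - ((2 * c : ℝ) : ℂ) • (1 : H →L[ℂ] H)) v, v⟫_ℂ =
            ((2 * ((⟪v, A x v⟫_ℂ).re - c * ‖v‖ ^ 2) : ℝ) : ℂ) := by
          rw [sub_apply, add_apply, inner_sub_left, inner_add_left,
            ContinuousLinearMap.star_eq_adjoint, ContinuousLinearMap.adjoint_inner_left,
            ← inner_conj_symm, add_comm, Complex.add_conj]
          simp only [smul_apply, one_apply_eq_self, inner_smul_left, inner_self_eq_norm_sq_to_K,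
            Complex.conj_ofReal]
          push_cast
          simp
          ring
        rw [h6]
        exact Complex.zero_le_real.2 (by have := hlow v; linarith)
    have h7 := hpos _ hP
    rw [map_sub, map_add, hfA, hstarA, hfA, map_smul, h1, zero_add, zero_sub, smul_eq_mul,
      mul_one, ← Complex.ofReal_neg, Complex.zero_le_real] at h7
    linarith
  obtain ⟨F, hF, hFε⟩ := Metric.mem_closure_iff.1 h0 ε hε
  obtain ⟨κ, _, t, z, ht, ht1, hz, rfl⟩ := mem_convexHull_iff_exists_fintype.1 hF
  choose v hv hvz using hz
  refine ⟨κ, inferInstance, t, v, ht, ht1, hv, fun q hq x => ?_⟩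
  rw [dist_zero_left] at hFε
  have h8 : (∑ i, t i • z i) ⟨q, hq⟩ x = ∑ i, (t i : ℂ) * (⟪v i, x (v i)⟫_ℂ -
          ⟪v i, ((π q : H →L[ℂ] H) * x * (π q⁻¹ : H →L[ℂ] H)) (v i)⟫_ℂ) := by
    simp only [← hvz, Finset.sum_apply, Pi.smul_apply, sum_apply, smul_apply, hΦ, Complex.real_smul]
  rw [← h8]
  refine (ContinuousLinearMap.le_opNorm _ _).trans ?_
  gcongr
  exact (norm_le_pi_norm _ _).trans hFε.le

end InvariantState

/-! ### Null coefficients -/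

section NullCoefficients

open Filter Topology
open scoped InnerProductSpace

variable {G : Type u} [Group G] {Q : Finset G} {r : ℝ}

theorem Null.add {φ ψ : G → ℂ} (hφ : Null Q φ) (hψ : Null Q ψ) : Null Q (φ + ψ) := by
  have := Tendsto.add hφ hψ
  rw [add_zero] at this
  exact this.congr fun k => by rw [map_add]; rfl

theorem Null.smul {φ : G → ℂ} (hφ : Null Q φ) (c : ℂ) : Null Q (c • φ) := by
  have := Tendsto.const_mul c hφ
  rw [mul_zero] at this
  exact this.congr fun k => by rw [map_smul]; rfl

theorem Null.sum {ι : Type*} (s : Finset ι) {φ : ι → G → ℂ} (h : ∀ i ∈ s, Null Q (φ i)) :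
    Null Q (∑ i ∈ s, φ i) := by
  have := tendsto_finsetSum s h
  rw [Finset.sum_const_zero] at this
  exact this.congr fun k => by rw [map_sum, Finset.sum_apply]

theorem null_of_approx {φ : G → ℂ}
    (h : ∀ ε : ℝ, 0 < ε → ∃ F : G → ℂ, Null Q F ∧ ∀ g, (‖φ g‖ : ℂ) ≤ F g + (ε : ℂ)) :
    Null Q φ := by
  rw [Null, Metric.tendsto_atTop]
  intro ε hε
  obtain ⟨F, hF, hφF⟩ := h (ε / 2) (by positivity)
  obtain ⟨N, hN⟩ := Metric.tendsto_atTop.1 hF (ε / 2) (by positivity)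
  refine ⟨N, fun k hk => ?_⟩
  have h1 := norm_avg_pow_le Q (F := F + ((ε / 2 : ℝ) : ℂ) • (1 : G → ℂ))
    (fun g => by simpa using hφF g) k 1
  rw [map_add, map_smul, avg_pow_one] at h1
  have h2 := (Complex.le_def.1 h1).1
  simp only [Complex.ofReal_re, Pi.add_apply, Pi.smul_apply, Pi.one_apply, smul_eq_mul, mul_one,
    Complex.add_re] at h2
  have h3 := hN k hk
  rw [dist_zero_right] at h3 ⊢
  have h4 := Complex.re_le_norm ((avg Q ^ k) F 1)
  linarith

/-- If the squares of a bounded family of functions, sublinear in a Hilbert space parameter, are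
null on a total set, they are null everywhere. -/
theorem null_sq_of_dense {H : Type*} [NormedAddCommGroup H] [InnerProductSpace ℂ H]
    {f : H → G → ℂ} (hadd : ∀ x y g, ‖f (x + y) g‖ ≤ ‖f x g‖ + ‖f y g‖)
    (hsmul : ∀ (c : ℂ) x g, ‖f (c • x) g‖ = ‖c‖ * ‖f x g‖) {C : ℝ}
    (hC : ∀ x g, ‖f x g‖ ≤ C * ‖x‖) {ι : Type*} {v : ι → H}
    (hv : (Submodule.span ℂ (Set.range v)).topologicalClosure = ⊤)
    (h : ∀ i, Null Q fun g => ((‖f (v i) g‖ ^ 2 : ℝ) : ℂ)) (x : H) :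
    Null Q fun g => ((‖f x g‖ ^ 2 : ℝ) : ℂ) := by
  have hadd2 : ∀ x y g, ‖f (x + y) g‖ ^ 2 ≤ 2 * ‖f x g‖ ^ 2 + 2 * ‖f y g‖ ^ 2 := fun x y g => by
    have h1 := pow_le_pow_left₀ (norm_nonneg _) (hadd x y g) 2
    nlinarith [sq_nonneg (‖f x g‖ - ‖f y g‖)]
  have hnorm : ∀ t : ℝ, (‖((t ^ 2 : ℝ) : ℂ)‖ : ℂ) = ((t ^ 2 : ℝ) : ℂ) := fun t => by
    rw [Complex.norm_real, Real.norm_of_nonneg (sq_nonneg t)]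
  let N : Submodule ℂ H :=
    { carrier := {x | Null Q fun g => ((‖f x g‖ ^ 2 : ℝ) : ℂ)}
      add_mem' := fun {x y} hx hy => by
        refine ((hx.smul 2).add (hy.smul 2)).of_norm_le fun g => ?_
        rw [hnorm]
        have := Complex.real_le_real.2 (hadd2 x y g)
        simpa using this
      zero_mem' := by
        have h0 : ∀ g, f 0 g = 0 := fun g => by
          have := hC 0 g
          rw [norm_zero, mul_zero] at this
          exact norm_le_zero_iff.1 this
        have h1 : (fun g => ((‖f 0 g‖ ^ 2 : ℝ) : ℂ)) = 0 := by ext g; simp [h0]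
        change Null Q _
        rw [h1]
        simp [Null]
      smul_mem' := fun c x hx => by
        have h1 : (fun g => ((‖f (c • x) g‖ ^ 2 : ℝ) : ℂ)) =
            ((‖c‖ ^ 2 : ℝ) : ℂ) • fun g => ((‖f x g‖ ^ 2 : ℝ) : ℂ) := by
          ext g
          rw [hsmul, mul_pow, Complex.ofReal_mul]
          rfl
        change Null Q _
        rw [h1]
        exact Null.smul hx _ }
  have hx : x ∈ closure (Submodule.span ℂ (Set.range v) : Set H) := by
    rw [← Submodule.topologicalClosure_coe, hv]
    trivial
  have hspan : Submodule.span ℂ (Set.range v) ≤ N := Submodule.span_le.2 (by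
    rintro _ ⟨i, rfl⟩
    exact h i)
  refine null_of_approx fun ε hε => ?_
  obtain ⟨y, hy, hxy⟩ := Metric.mem_closure_iff.1 hx (√(ε / 2) / (|C| + 1)) (by positivity)
  refine ⟨(2 : ℂ) • fun g => ((‖f y g‖ ^ 2 : ℝ) : ℂ), Null.smul (hspan hy) 2, fun g => ?_⟩
  have h1 : ‖f (x - y) g‖ ≤ √(ε / 2) := by
    rw [dist_eq_norm, lt_div_iff₀ (by positivity)] at hxy
    refine (hC _ _).trans ?_
    calc C * ‖x - y‖ ≤ (|C| + 1) * ‖x - y‖ := by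
          gcongr; linarith [le_abs_self C]
      _ ≤ _ := by rw [mul_comm]; exact hxy.le
  have h2 : ‖f (x - y) g‖ ^ 2 ≤ ε / 2 := by
    rw [← Real.sq_sqrt (show 0 ≤ ε / 2 by positivity)]
    exact pow_le_pow_left₀ (norm_nonneg _) h1 2
  have h3 := hadd2 y (x - y) g
  rw [add_sub_cancel] at h3
  have h4 : ‖f x g‖ ^ 2 ≤ 2 * ‖f y g‖ ^ 2 + ε := by linarith
  rw [hnorm]
  simpa using Complex.real_le_real.2 h4

variable {H : Type u} [NormedAddCommGroup H] [InnerProductSpace ℂ H] [CompleteSpace H]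

/-- On the orbit of ξ, conjugation invariance turns the squared coefficient into the translate g ↦
(χχ̄)(s t⁻¹ g). It is null because the averages of χχ̄ tend to 0 at every point, not only at 1.
Density then extends this to each vector in turn. -/
theorem IsGNSTriplet.null_coefficient {χ : G → ℂ} {π : UnitaryRep G H} {ξ : H}
    (h : IsGNSTriplet χ π ξ) (hQ : HasGap Q r) (hχ : χ ∈ traces G) (hnull : Null Q (χ * star χ))
    (a b : H) : Null Q fun g => ((‖⟪a, (π g : H →L[ℂ] H) b⟫_ℂ‖ ^ 2 : ℝ) : ℂ) := by
  have hbase : ∀ s t : G, Null Q fun g =>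
      ((‖⟪(π t : H →L[ℂ] H) ξ, (π g : H →L[ℂ] H) ((π s : H →L[ℂ] H) ξ)⟫_ℂ‖ ^ 2 : ℝ) : ℂ) := by
    intro s t
    have h1 : (fun g => ((‖⟪(π t : H →L[ℂ] H) ξ,
        (π g : H →L[ℂ] H) ((π s : H →L[ℂ] H) ξ)⟫_ℂ‖ ^ 2 : ℝ) : ℂ)) =
        fun g => (χ * star χ) (s * t⁻¹ * g) := by
      ext g
      rw [← π.mul_apply, π.inner_apply_apply, ← h.2]
      have h2 : χ (t⁻¹ * (g * s)) = χ (s * t⁻¹ * g) := by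
        have := congrFun (hχ.2 s) (s * t⁻¹ * g)
        rw [← this, conjFun]
        congr 1
        group
      rw [h2, Pi.mul_apply, Pi.star_apply, Complex.star_def, Complex.mul_conj,
        Complex.normSq_eq_norm_sq]
    rw [h1, Null]
    simp only [avg_pow_translate, mul_one]
    exact hQ.tendsto_of_null (mul_mem_PD₁ hχ.1 (star_mem_PD₁ hχ.1)) hnull _
  refine null_sq_of_dense (f := fun b g => ⟪a, (π g : H →L[ℂ] H) b⟫_ℂ) (C := ‖a‖)
    (fun x y g => by rw [map_add, inner_add_right]; exact norm_add_le _ _)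
    (fun c x g => by rw [map_smul, inner_smul_right, norm_mul])
    (fun x g => by rw [← π.norm_apply g x]; exact norm_inner_le_norm _ _) h.1 (fun s => ?_) b
  exact null_sq_of_dense
    (f := fun a g => ⟪a, (π g : H →L[ℂ] H) ((π s : H →L[ℂ] H) ξ)⟫_ℂ) (C := ‖ξ‖)
    (fun x y g => by rw [inner_add_left]; exact norm_add_le _ _)
    (fun c x g => by rw [inner_smul_left, norm_mul, RCLike.norm_conj])
    (fun x g => by
      rw [← π.norm_apply s ξ, ← π.norm_apply g ((π s : H →L[ℂ] H) ξ), mul_comm]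
      exact norm_inner_le_norm _ _) h.1 (fun t => hbase s t) a

/-- Diagonal coefficients of the conjugation representation on Hilbert–Schmidt operators. -/
theorem hilbertSchmidt_coefficient_mem_PD₁ {ι : Type*} [Fintype ι] (π : UnitaryRep G H)
    {e : ι → H} (he : Orthonormal ℂ e) {a : ι → ℝ} (ha : ∑ i, a i ^ 2 = 1) :
    (∑ i, ∑ j, ((a i * a j : ℝ) : ℂ) •
      fun g => ((‖⟪e i, (π g : H →L[ℂ] H) (e j)⟫_ℂ‖ ^ 2 : ℝ) : ℂ)) ∈ PD₁ G := by
  classical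
  constructor
  · intro n g
    -- Since Mᵀ is the conjugate of M, the Hadamard product has the squared moduli as entries and is
    -- positive by the Schur product theorem. Compression by B sums them with the weights a i * a j.
    let M : Matrix (Fin n × ι) (Fin n × ι) ℂ := Matrix.gram ℂ fun p => (π (g p.1) : H →L[ℂ] H) (e p.2)
    have hM : M.PosSemidef := Matrix.posSemidef_gram ℂ _
    let B : Matrix (Fin n × ι) (Fin n) ℂ := Matrix.of fun p k => if p.1 = k then (a p.2 : ℂ) else 0
    have := (hM.hadamard hM.transpose).conjTranspose_mul_mul_same B
    suffices hEq : (Matrix.of fun k l => (∑ i, ∑ j, ((a i * a j : ℝ) : ℂ) •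
        fun x => ((‖⟪e i, (π x : H →L[ℂ] H) (e j)⟫_ℂ‖ ^ 2 : ℝ) : ℂ)) ((g k)⁻¹ * g l)) =
        B.conjTranspose * M.hadamard M.transpose * B by
      rw [hEq]
      exact this
    ext k l
    simp only [Matrix.mul_apply, Matrix.of_apply, Matrix.conjTranspose_apply, Matrix.hadamard_apply,
      Matrix.transpose_apply, M, B, Matrix.gram_apply, Fintype.sum_prod_type, Finset.sum_apply,
      Pi.smul_apply, smul_eq_mul]
    simp only [RCLike.star_def, apply_ite (starRingEnd ℂ), map_zero, Complex.conj_ofReal, ite_mul,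
      zero_mul, mul_ite, mul_zero]
    simp only [Finset.sum_ite_irrel, Finset.sum_const_zero, Finset.sum_ite_eq', Finset.mem_univ,
      if_true, Finset.sum_mul]
    rw [Finset.sum_comm]
    refine Finset.sum_congr rfl fun j _ => Finset.sum_congr rfl fun i _ => ?_
    rw [inner_mul_inner_self, π.inner_apply_apply]
    push_cast
    ring
  · simp only [Finset.sum_apply, Pi.smul_apply, smul_eq_mul, map_one, OneMemClass.coe_one,
      one_apply_eq_self, orthonormal_iff_ite.1 he]
    have h1 : ∀ i j, ((a i * a j : ℝ) : ℂ) * ((‖(if i = j then 1 else 0 : ℂ)‖ ^ 2 : ℝ) : ℂ) =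
        if i = j then ((a i ^ 2 : ℝ) : ℂ) else 0 := by
      intro i j
      split_ifs with h
      · subst h; simp [sq]
      · simp
    simp only [h1, Finset.sum_ite_eq, Finset.mem_univ, if_true]
    rw [← Complex.ofReal_sum, ha, Complex.ofReal_one]

/-- The state is x ↦ ⟨ξ, E(x)ξ⟩, the canonical trace composed with the conditional expectation.
Bimodularity moves π(g) outside E, and traciality absorbs it. -/
theorem IsGNSTriplet.exists_invariant_state {χ : G → ℂ} {π : UnitaryRep G H} {ξ : H}
    (h : IsGNSTriplet χ π ξ) (hχ : χ ∈ traces G) (hM : IsAmenableVN π.vonNeumannAlgebra) :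
    ∃ f : (H →L[ℂ] H) →ₗ[ℂ] ℂ, (∀ x : H →L[ℂ] H, x.IsPositive → 0 ≤ f x) ∧ f 1 = 1 ∧
      ∀ (g : G) (x : H →L[ℂ] H),
        f ((π g : H →L[ℂ] H) * x * (π g⁻¹ : H →L[ℂ] H)) = f x := by
  obtain ⟨E, hE⟩ := hM
  have hmem : ∀ g, (π g : H →L[ℂ] H) ∈ π.vonNeumannAlgebra := fun g => by
    rw [← SetLike.mem_coe, π.coe_vonNeumannAlgebra]
    exact Set.subset_centralizer_centralizer ⟨g, rfl⟩
  refine ⟨(innerSL ℂ ξ : H →ₗ[ℂ] ℂ) ∘ₗ (ContinuousLinearMap.apply ℂ H ξ : (H →L[ℂ] H) →ₗ[ℂ] H) ∘ₗ E,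
    fun x hx => ?_, ?_, fun g x => ?_⟩
  · exact (hE.positive x hx).inner_nonneg_right ξ
  · have h1 : E 1 = 1 := hE.apply_of_mem 1 (one_mem _)
    have h2 := h.norm_eq_one hχ.1.2
    simp [h1, h2]
  · simp only [LinearMap.comp_apply, ContinuousLinearMap.coe_coe, innerSL_apply_apply,
      ContinuousLinearMap.apply_apply]
    rw [hE.bimodule _ (hmem g) _ (hmem g⁻¹), mul_apply_eq_comp, mul_apply_eq_comp,
      π.inner_apply_right]
    -- V is right translation by g⁻¹, isometric because χ is conjugation invariant. It commutes with
    -- every π(k), hence with E(x) in the double commutant, and it sends ξ to π(g⁻¹)ξ.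
    obtain ⟨V, hV, hVn⟩ := exists_isometry_of_inner_eq
      (w := fun k => (π (k * g⁻¹) : H →L[ℂ] H) ξ) h.1 (fun i j => by
        rw [π.inner_apply_apply, π.inner_apply_apply, ← h.2, ← h.2]
        have := congrFun (hχ.2 g⁻¹) (i⁻¹ * j)
        rw [← this, conjFun]
        congr 1
        group)
    have hcomm : E x * V = V * E x := by
      have h3 := hE.mem x
      rw [← SetLike.mem_coe, π.coe_vonNeumannAlgebra] at h3
      refine (h3 V ?_).symm
      rintro _ ⟨k, rfl⟩
      refine clm_ext_of_dense_span h.1 fun i => ?_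
      simp only [mul_apply_eq_comp]
      rw [← π.mul_apply, hV, hV, ← π.mul_apply, mul_assoc]
    have hV1 : (π g⁻¹ : H →L[ℂ] H) ξ = V ξ := by
      have := hV 1
      simpa using this.symm
    rw [hV1]
    have h4 : E x (V ξ) = V (E x ξ) := congrArg (fun T : H →L[ℂ] H => T ξ) hcomm
    rw [h4]
    exact (⟨V.toLinearMap, hVn⟩ : H →ₗᵢ[ℂ] H).inner_map_map _ _

/-- Amenability makes the coefficient ψ of a Hilbert–Schmidt unit vector close to 1 on Q. If χχ̄
were null, ψ would be null as well, and the gap would bound its first average by r. -/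
theorem HasGap.not_null_of_isVonNeumannAmenable (hQ : HasGap Q r) {χ : G → ℂ} (hχ : χ ∈ traces G)
    (hvN : IsVonNeumannAmenable χ) : ¬ Null Q (χ * star χ) := by
  classical
  intro hnull
  obtain ⟨H, _, _, _, π, ξ, hGNS, hM⟩ := hvN
  obtain ⟨f, hpos, h1, hinv⟩ := hGNS.exists_invariant_state hχ hM
  -- Almost invariance up to 1 - r yields ψ(q) ≥ (1 + r)/2 > r on Q through Powers–Størmer.
  have hr : 0 < 1 - r := by linarith [hQ.2.1]
  obtain ⟨κ, _, t, v, ht, ht1, hv, hQv⟩ :=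
    exists_almost_invariant_of_invariant_state π Q f hpos h1 hinv hr
  obtain ⟨n, e, a, he, ha, hea⟩ := exists_orthonormal_diagonalization t ht v
  have ha1 : ∑ j, a j ^ 2 = 1 := by
    have := hea 1
    simp only [one_apply_eq_self, inner_self_eq_norm_sq_to_K, hv, he.1] at this
    have h2 : ((∑ i, t i : ℝ) : ℂ) = ((∑ j, a j ^ 2 : ℝ) : ℂ) := by
      push_cast
      simpa using this
    rw [ht1] at h2
    exact_mod_cast h2.symm
  set ψ : G → ℂ := ∑ i, ∑ j, ((a i * a j : ℝ) : ℂ) •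
      fun g => ((‖⟪e i, (π g : H →L[ℂ] H) (e j)⟫_ℂ‖ ^ 2 : ℝ) : ℂ) with hψ
  have hψP : ψ ∈ PD₁ G := hilbertSchmidt_coefficient_mem_PD₁ π he ha1
  have hψN : Null Q ψ := Null.sum _ fun i _ => Null.sum _ fun j _ =>
    (hGNS.null_coefficient hQ hχ hnull _ _).smul _
  set p : G → ℝ := fun g => ∑ i, ∑ j, a i * a j * ‖⟪e i, (π g : H →L[ℂ] H) (e j)⟫_ℂ‖ ^ 2 with hp
  have hψp : ∀ g, ψ g = (p g : ℂ) := fun g => by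
    simp only [hψ, hp, Finset.sum_apply, Pi.smul_apply, smul_eq_mul]
    push_cast
    rfl
  have hp1 : p 1 = 1 := by
    have := hψP.2
    rw [hψp] at this
    exact_mod_cast this
  have hpQ : ∀ q ∈ Q, r < p q := by
    intro q hq
    have hf : Orthonormal ℂ fun j => (π q⁻¹ : H →L[ℂ] H) (e j) :=
      he.comp_linearIsometry (⟨(π q⁻¹ : H →L[ℂ] H).toLinearMap, π.norm_apply q⁻¹⟩ : H →ₗᵢ[ℂ] H)
    have hPS := powers_stormer he hf ha (δ := 1 - r) fun x hx => by
      have h2 := hQv q hq x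
      simp only [mul_sub, Finset.sum_sub_distrib, hea] at h2
      simp only [mul_sub, Finset.sum_sub_distrib]
      refine le_trans (le_of_eq ?_) (h2.trans (mul_le_of_le_one_right hr.le hx))
      simp only [mul_apply_eq_comp, π.inner_apply_right q]
    rw [ha1] at hPS
    have h3 : p q = ∑ i, ∑ j, a i * a j * ‖⟪e i, (π q⁻¹ : H →L[ℂ] H) (e j)⟫_ℂ‖ ^ 2 := by
      simp only [hp]
      rw [Finset.sum_comm]
      refine Finset.sum_congr rfl fun i _ => Finset.sum_congr rfl fun j _ => ?_
      rw [π.inner_apply_right, norm_inner_symm, mul_comm (a j)]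
    rw [← h3] at hPS
    linarith [hQ.2.1]
  -- Already one averaging step suffices: the average of ψ(1) = 1 and of values exceeding r on Q is
  -- larger than r.
  have h4 := (hQ.null_iff hψP).1 hψN 1
  have h5 : (avg Q ^ 1) ψ 1 = ((((Q.card : ℝ) + 1)⁻¹ * (1 + ∑ q ∈ Q, p q) : ℝ) : ℂ) := by
    rw [pow_one, avg_apply, hψp, hp1]
    simp only [one_mul, hψp]
    push_cast
    rfl
  rw [h5, Complex.norm_real, pow_one] at h4
  have h6 := (le_abs_self _).trans h4
  rw [inv_mul_le_iff₀ (by positivity)] at h6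
  have h7 : ∑ q ∈ Q, p q ≥ Q.card * r := by
    rw [← nsmul_eq_mul]
    exact Finset.card_nsmul_le_sum Q p r fun q hq => (hpQ q hq).le
  nlinarith [hQ.2.1]

end NullCoefficients

/-! ### The space of subgroups -/

section Chabauty

open Filter Topology

variable {G : Type u} [Group G]

open Classical in
theorem isInducing_decide_mem :
    IsInducing fun (K : Subgroup G) (g : G) => decide (g ∈ K) := ⟨rfl⟩

open Classical in
theorem isClopen_mem (g : G) : IsClopen {K : Subgroup G | g ∈ K} := by
  have h : Continuous fun K : Subgroup G => decide (g ∈ K) :=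
    (continuous_apply g).comp isInducing_decide_mem.continuous
  have h2 : {K : Subgroup G | g ∈ K} = (fun K : Subgroup G => decide (g ∈ K)) ⁻¹' {true} := by
    ext K; simp
  rw [h2]
  exact (isClopen_discrete _).preimage h

open Classical in
instance : T2Space (Subgroup G) := by
  refine T2Space.of_injective_continuous
    (f := fun (K : Subgroup G) (g : G) => decide (g ∈ K)) (fun K L h => ?_) ?_
  · ext g
    simpa using congrFun h g
  · exact isInducing_decide_mem.continuous

open Classical in
instance : CompactSpace (Subgroup G) := by
  rw [← isCompact_univ_iff, isInducing_decide_mem.isCompact_iff, Set.image_univ]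
  have hrange : Set.range (fun (K : Subgroup G) (g : G) => decide (g ∈ K)) =
      {f : G → Bool | f 1 = true} ∩ ⋂ (a : G) (b : G), {f | (f a && f b && !f (a * b⁻¹)) = false} := by
    ext f
    simp only [Set.mem_range, Set.mem_inter_iff, Set.mem_iInter, Set.mem_ofPred_eq]
    constructor
    · rintro ⟨K, rfl⟩
      refine ⟨by simp [K.one_mem], fun a b => ?_⟩
      by_cases ha : a ∈ K <;> by_cases hb : b ∈ K <;>
        simp [ha, hb, K.mul_mem_cancel_left]
    · rintro ⟨h1, h2⟩
      have h3 : ∀ a b, f a = true → f b = true → f (a * b⁻¹) = true := fun a b ha hb => by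
        have := h2 a b
        simpa [ha, hb] using this
      have hinv : ∀ b, f b = true → f b⁻¹ = true := fun b hb => by simpa using h3 1 b h1 hb
      refine ⟨{ carrier := {g | f g = true}
                one_mem' := h1
                mul_mem' := fun {a b} ha hb => by simpa using h3 a b⁻¹ ha (hinv b hb)
                inv_mem' := fun {b} hb => hinv b hb }, ?_⟩
      ext g
      rw [Bool.eq_iff_iff, decide_eq_true_iff]
      rfl
  rw [hrange]
  refine IsClosed.isCompact ((isClosed_eq (continuous_apply _) continuous_const).inter
    (isClosed_iInter fun a => isClosed_iInter fun b => isClosed_eq ?_ continuous_const))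
  exact (continuous_of_discreteTopology (f := fun p : Bool × Bool × Bool =>
    p.1 && p.2.1 && !p.2.2)).comp (by fun_prop : Continuous fun f : G → Bool =>
      (f a, f b, f (a * b⁻¹)))

instance : BorelSpace (Subgroup G) := ⟨rfl⟩

theorem mem_conj_smul {g : ConjAct G} {K : Subgroup G} {x : G} :
    x ∈ g • K ↔ (ConjAct.ofConjAct g)⁻¹ * x * ConjAct.ofConjAct g ∈ K := by
  rw [Subgroup.mem_pointwise_smul_iff_inv_smul_mem, ConjAct.smul_def]
  simp

theorem continuous_indicatorFun : Continuous (indicatorFun : Subgroup G → G → ℂ) := by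
  refine continuous_pi fun g => ?_
  have : (fun K : Subgroup G => indicatorFun K g) =
      {K : Subgroup G | g ∈ K}.indicator fun _ => 1 := by
    ext K
    by_cases h : g ∈ K <;> simp [indicatorFun, h]
  rw [this]
  exact (isClopen_mem g).continuous_indicator continuous_const

open Classical in
theorem continuous_conj_smul (g : ConjAct G) : Continuous fun K : Subgroup G => g • K := by
  refine isInducing_decide_mem.continuous_iff.2 (continuous_pi fun x => ?_)
  have h : Continuous fun K : Subgroup G =>
      decide ((ConjAct.ofConjAct g)⁻¹ * x * ConjAct.ofConjAct g ∈ K) :=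
    (continuous_apply _).comp isInducing_decide_mem.continuous
  simpa only [Function.comp_def, mem_conj_smul] using h

theorem conjFun_indicatorFun (g : G) (K : Subgroup G) :
    conjFun g (indicatorFun K) = indicatorFun (ConjAct.toConjAct g • K) := by
  classical
  ext x
  simp only [conjFun, indicatorFun_apply, mem_conj_smul, ConjAct.ofConjAct_toConjAct]

theorem indicatorFun_nonneg (K : Subgroup G) (g : G) : 0 ≤ indicatorFun K g := by
  classical
  rw [indicatorFun_apply]; split_ifs <;> simp

/-- K normalizes itself, so a conjugate depends only on the coset of the conjugating element. -/
theorem finite_orbit_of_finiteIndex (K : Subgroup G) [K.FiniteIndex] :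
    (MulAction.orbit (ConjAct G) K).Finite := by
  have : Finite (G ⧸ K) := Subgroup.finite_quotient_of_finiteIndex
  refine (Set.finite_range fun a : G ⧸ K => ConjAct.toConjAct a.out • K).subset ?_
  rintro _ ⟨g, rfl⟩
  refine ⟨(ConjAct.ofConjAct g : G), ?_⟩
  obtain ⟨k, hk⟩ := QuotientGroup.mk_out_eq_mul K (ConjAct.ofConjAct g)
  ext x
  simp only [mem_conj_smul, ConjAct.ofConjAct_toConjAct, hk]
  rw [show ((ConjAct.ofConjAct g * (k : G))⁻¹ * x * (ConjAct.ofConjAct g * (k : G))) =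
    (k : G)⁻¹ * ((ConjAct.ofConjAct g)⁻¹ * x * ConjAct.ofConjAct g) * k by group,
    K.mul_mem_cancel_right k.2, K.mul_mem_cancel_left (K.inv_mem k.2)]

theorem countable_le (R : Subgroup G) [Countable (Subgroup R)] :
    {K : Subgroup G | K ≤ R}.Countable := by
  refine (Set.countable_range fun L : Subgroup R => L.map R.subtype).mono fun K hK => ?_
  exact ⟨K.subgroupOf R, Subgroup.map_subgroupOf_eq_of_le hK⟩

theorem isClosed_le_subgroup (R : Subgroup G) : IsClosed {K : Subgroup G | K ≤ R} := by
  have : {K : Subgroup G | K ≤ R} = ⋂ g ∉ R, {K : Subgroup G | g ∈ K}ᶜ := by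
    ext K
    simp only [Set.mem_ofPred_eq, Set.mem_iInter, Set.mem_compl_iff]
    exact ⟨fun h g hg hgK => hg (h hgK), fun h g hgK => by_contra fun hg => h g hg hgK⟩
  rw [this]
  exact isClosed_biInter fun g _ => (isClopen_mem g).compl.isClosed

theorem normal_amenableRadical : (amenableRadical G).Normal :=
  Subgroup.sSup_normal _ fun _ h => h.1

end Chabauty

/-! ### Vanishing outside the amenable radical -/

section Charmenable

variable {G : Type u} [Group G] {Q : Finset G} {r : ℝ}

/-- The character dichotomy enters here: nullity of χχ̄ rules out its amenable alternative. -/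
theorem IsCharmenable.eq_zero_of_null (hG : IsCharmenable G) (hQ : HasGap Q r) {τ : G → ℂ}
    (hτ : τ ∈ traces G) (hpos : ∀ g, 0 ≤ τ g) (hnull : Null Q τ) {g : G}
    (hg : g ∉ amenableRadical G) : τ g = 0 :=
  hQ.eq_zero_of_mem_mixingTraces (S := amenableRadical G)
    (fun χ hχ => (hG.character_dichotomy χ hχ).imp (fun h g hg => h g hg)
      fun h => hQ.not_null_of_isVonNeumannAmenable hχ.1 h)
    (mem_mixingTraces hτ hpos hnull) hg

end Charmenable

/-! ### Uniformly recurrent subgroups -/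

section URS

open Filter Topology

variable {G : Type u} [Group G] {Q : Finset G} {r : ℝ}

theorem IsURS.finite_of_finiteIndex {X : Set (Subgroup G)} (hX : IsURS X) {K : Subgroup G}
    (hK : K ∈ X) (hfin : K.FiniteIndex) : X.Finite := by
  have hO := finite_orbit_of_finiteIndex K
  have hsub : MulAction.orbit (ConjAct G) K ⊆ X := by
    rintro _ ⟨g, rfl⟩
    exact hX.1.2.2 g K hK
  rw [← hX.2 _ hsub ⟨⟨K, MulAction.mem_orbit_self K⟩, hO.isClosed, fun g L hL => ?_⟩]
  · exact hO
  · obtain ⟨h, rfl⟩ := hL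
    exact ⟨g * h, mul_smul g h K⟩

/-- Baire gives an isolated point x. The translates of a neighbourhood isolating it cover X, by
compactness finitely many suffice, and each meets X in a single point. -/
theorem IsURS.finite_of_countable {X : Set (Subgroup G)} (hX : IsURS X) (hc : X.Countable) :
    X.Finite := by
  have hcomp : IsCompact X := hX.1.2.1.isCompact
  have : CompactSpace X := isCompact_iff_compactSpace.1 hcomp
  have : Countable X := hc.to_subtype
  have : Nonempty X := hX.1.1.to_subtype
  obtain ⟨x, hx⟩ := nonempty_interior_of_iUnion_of_closed (f := fun x : X => ({x} : Set X))
    (fun x => isClosed_singleton) (Set.iUnion_of_singleton X)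
  have hopen : IsOpen ({x} : Set X) := by
    rw [← interior_eq_iff_isOpen]
    exact interior_subset.antisymm (Set.singleton_subset_iff.2 (by
      obtain ⟨y, hy⟩ := hx
      have : y = x := Set.mem_singleton_iff.1 (interior_subset hy)
      rwa [this] at hy))
  obtain ⟨U, hU, hUx⟩ := isOpen_induced_iff.1 hopen
  have hUx' : ∀ y ∈ X, y ∈ U → y = x := fun y hy hyU => by
    have : (⟨y, hy⟩ : X) ∈ ({x} : Set X) := hUx ▸ hyU
    exact congrArg Subtype.val this
  have hxU : (x : Subgroup G) ∈ U := by
    have : x ∈ Subtype.val ⁻¹' U := hUx ▸ Set.mem_singleton x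
    exact this
  -- The part of X missed by all translates is closed and invariant. If non-empty it would be X by
  -- minimality, yet it omits x.
  have hcover : X ⊆ ⋃ g : ConjAct G, (fun K : Subgroup G => g • K) ⁻¹' U := by
    by_contra hcon
    obtain ⟨y, hy, hyU⟩ := Set.not_subset.1 hcon
    have hZ : X \ (⋃ g : ConjAct G, (fun K : Subgroup G => g • K) ⁻¹' U) = X := by
      refine hX.2 _ Set.sdiff_subset ⟨⟨y, hy, hyU⟩, ?_, fun g K hK => ⟨hX.1.2.2 g K hK.1, ?_⟩⟩
      · exact hX.1.2.1.sdiff (isOpen_iUnion fun g => hU.preimage (continuous_conj_smul g))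
      · rintro ⟨_, ⟨h, rfl⟩, hh⟩
        refine hK.2 (Set.mem_iUnion.2 ⟨h * g, ?_⟩)
        simpa [mul_smul] using hh
    exact (hZ.ge x.2).2 (Set.mem_iUnion.2 ⟨1, by simpa using hxU⟩)
  obtain ⟨F, hF⟩ := hcomp.elim_finite_subcover _
    (fun g => hU.preimage (continuous_conj_smul g)) hcover
  refine (F.finite_toSet.image fun g => g⁻¹ • (x : Subgroup G)).subset fun y hy => ?_
  obtain ⟨g, hg, hgU⟩ := Set.mem_iUnion₂.1 (hF hy)
  refine ⟨g, hg, ?_⟩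
  have := hUx' (g • y) (hX.1.2.2 g y hy) hgU
  simp only [← this, inv_smul_smul]

theorem IsCharmenable.finite_of_isURS (hG : IsCharmenable G) (hQ : HasGap Q r)
    (hRad : Countable (Subgroup (amenableRadical G))) {X : Set (Subgroup G)} (hX : IsURS X) :
    X.Finite := by
  set C : Set (G → ℂ) := closure (convexHull ℝ (indicatorFun '' X)) with hC
  -- An induction principle: closed convex conditions satisfied by the indicators pass to the trace
  -- φ found below.
  have hmin : ∀ D : Set (G → ℂ), IsClosed D → Convex ℝ D → (∀ K ∈ X, indicatorFun K ∈ D) → C ⊆ D :=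
    fun D hD hD' h => closure_minimal (convexHull_min (by rintro _ ⟨K, hK, rfl⟩; exact h K hK) hD') hD
  have hmem : ∀ K ∈ X, indicatorFun K ∈ C := fun K hK =>
    subset_closure (subset_convexHull ℝ _ ⟨K, hK, rfl⟩)
  have hCconv : Convex ℝ C := (convex_convexHull ℝ _).closure
  have hCPD : C ⊆ PD₁ G := hmin _ isClosed_PD₁ convex_PD₁ fun K _ => indicatorFun_mem_PD₁ K
  have hCinv : ∀ g : G, ∀ φ ∈ C, conjFun g φ ∈ C := by
    intro g
    refine hmin {φ | conjFun g φ ∈ C} ?_ ?_ ?_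
    · exact isClosed_closure.preimage (continuous_pi fun x => continuous_apply _)
    · intro φ hφ ψ hψ a b ha hb hab
      exact hCconv hφ hψ ha hb hab
    · intro K hK
      change conjFun g (indicatorFun K) ∈ C
      rw [conjFun_indicatorFun]
      exact hmem _ (hX.1.2.2 _ K hK)
  obtain ⟨K₀, hK₀⟩ := hX.1.1
  obtain ⟨φ, hφC, hφ⟩ := hG.ubiquity_of_traces C hCPD ⟨_, hmem K₀ hK₀⟩
    (isCompact_PD₁.of_isClosed_subset isClosed_closure hCPD) hCconv hCinv
  have hpos : ∀ g, 0 ≤ φ g := fun g => by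
    refine hmin {φ | 0 ≤ φ g} (isClosed_le continuous_const (continuous_apply g)) ?_
      (fun K _ => indicatorFun_nonneg K g) hφC
    intro φ hφ ψ hψ a b ha hb _
    have h1 : 0 ≤ φ g := hφ
    have h2 : 0 ≤ ψ g := hψ
    have h3 := mul_nonneg (Complex.zero_le_real.2 ha) h1
    have h4 := mul_nonneg (Complex.zero_le_real.2 hb) h2
    simpa using add_nonneg h3 h4
  by_cases hnull : ∃ K ∈ X, ¬ Null Q (indicatorFun K)
  · obtain ⟨K, hK, hKn⟩ := hnull
    exact hX.finite_of_finiteIndex hK (hQ.finiteIndex hKn)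
  push Not at hnull
  have hφnull : Null Q φ := by
    rw [hQ.null_iff hφ.1]
    intro k
    refine hmin {φ | ‖(avg Q ^ k) φ 1‖ ≤ r ^ k} ?_ ?_ (fun K hK =>
      (hQ.null_iff (indicatorFun_mem_PD₁ K)).1 (hnull K hK) k) hφC
    · exact isClosed_le ((continuous_apply (1 : G)).comp (continuous_avg_pow Q k)).norm
        continuous_const
    · have h1 : {φ : G → ℂ | ‖(avg Q ^ k) φ 1‖ ≤ r ^ k} =
          (LinearMap.proj (1 : G) ∘ₗ (avg Q ^ k).restrictScalars ℝ) ⁻¹'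
            Metric.closedBall (0 : ℂ) (r ^ k) := by
        ext φ; simp
      rw [h1]
      exact (convex_closedBall _ _).linear_preimage _
  have hzero := fun g => hG.eq_zero_of_null hQ hφ hpos hφnull (g := g)
  -- Otherwise compactness gives finitely many g outside the radical such that every K in X contains
  -- one of them. Then ∑ φ(g) ≥ 1, although φ vanishes at each of these g.
  obtain ⟨K, hK, hKR⟩ : ∃ K ∈ X, K ≤ amenableRadical G := by
    by_contra! hcon
    have hcover : X ⊆ ⋃ g : {g : G // g ∉ amenableRadical G}, {K : Subgroup G | (g : G) ∈ K} := by
      intro K hK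
      obtain ⟨g, hgK, hg⟩ := SetLike.not_le_iff_exists.1 (hcon K hK)
      exact Set.mem_iUnion.2 ⟨⟨g, hg⟩, hgK⟩
    obtain ⟨F, hF⟩ := hX.1.2.1.isCompact.elim_finite_subcover
      (fun g : {g : G // g ∉ amenableRadical G} => {K : Subgroup G | (g : G) ∈ K})
      (fun g => (isClopen_mem (g : G)).isOpen) hcover
    have h1 : 1 ≤ ∑ g ∈ F, (φ g).re := by
      refine hmin {φ | 1 ≤ ∑ g ∈ F, (φ g).re} (isClosed_le continuous_const (by fun_prop)) ?_ ?_ hφC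
      · intro φ hφ ψ hψ a b ha hb hab
        have h1 : 1 ≤ ∑ g ∈ F, (φ g).re := hφ
        have h2 : 1 ≤ ∑ g ∈ F, (ψ g).re := hψ
        simp only [Set.mem_ofPred_eq, Pi.add_apply, Pi.smul_apply, Complex.add_re, Complex.smul_re,
          smul_eq_mul, Finset.sum_add_distrib, ← Finset.mul_sum]
        nlinarith
      · intro K hK
        obtain ⟨g, hg, hgK⟩ := Set.mem_iUnion₂.1 (hF hK)
        have h2 : (indicatorFun K g).re = 1 := by
          have hgK' : (g : G) ∈ K := hgK
          simp [indicatorFun, hgK']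
        change 1 ≤ ∑ g ∈ F, (indicatorFun K g).re
        rw [← h2]
        exact Finset.single_le_sum (f := fun g : {g : G // g ∉ amenableRadical G} =>
          (indicatorFun K g).re) (fun g _ => (Complex.le_def.1 (indicatorFun_nonneg K g)).1) hg
    have h2 : ∑ g ∈ F, (φ g).re = 0 := Finset.sum_eq_zero fun g _ => by rw [hzero g g.2]; rfl
    linarith
  -- The radical is normal, so the members of X inside it form a subsystem, and minimality puts all
  -- of X there.
  have hsub : X ∩ {K | K ≤ amenableRadical G} = X := by
    refine hX.2 _ Set.inter_subset_left ⟨⟨K, hK, hKR⟩,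
      hX.1.2.1.inter (isClosed_le_subgroup _), fun g L hL => ⟨hX.1.2.2 g L hL.1, fun x hx => ?_⟩⟩
    have h1 := hL.2 (mem_conj_smul.1 hx)
    have h2 := normal_amenableRadical.conj_mem _ h1 (ConjAct.ofConjAct g)
    simpa [mul_assoc] using h2
  refine hX.finite_of_countable ((countable_le (amenableRadical G)).mono ?_)
  rw [← hsub]
  exact Set.inter_subset_right

end URS

/-! ### Invariant random subgroups -/

section IRS

open Filter Topology MeasureTheory

variable {G : Type u} [Group G] {Q : Finset G} {r : ℝ} {μ : Measure (Subgroup G)}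

/-- The trace `g ↦ μ {K | g ∈ K}` of an invariant random subgroup. -/
noncomputable def irsTrace (μ : Measure (Subgroup G)) : G → ℂ :=
  fun g => ∫ K, indicatorFun K g ∂μ

theorem norm_avg_pow_indicatorFun_le (Q : Finset G) (K : Subgroup G) (k : ℕ) (g : G) :
    ‖(avg Q ^ k) (indicatorFun K) g‖ ≤ 1 := by
  have h := norm_avg_pow_le Q (φ := indicatorFun K) (F := 1) (fun g => by
    rw [Pi.one_apply]
    exact_mod_cast norm_le_one_of_mem_PD₁ (indicatorFun_mem_PD₁ K) g) k g
  rw [avg_pow_one, Pi.one_apply] at h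
  exact_mod_cast h

theorem continuous_avg_pow_indicatorFun (Q : Finset G) (k : ℕ) (g : G) :
    Continuous fun K : Subgroup G => (avg Q ^ k) (indicatorFun K) g :=
  (continuous_apply g).comp ((continuous_avg_pow Q k).comp continuous_indicatorFun)

theorem integrable_avg_pow_indicatorFun [IsFiniteMeasure μ] (Q : Finset G) (k : ℕ) (g : G) :
    Integrable (fun K : Subgroup G => (avg Q ^ k) (indicatorFun K) g) μ :=
  Integrable.of_bound (continuous_avg_pow_indicatorFun Q k g).measurable.aestronglyMeasurable 1
    (Eventually.of_forall fun K => norm_avg_pow_indicatorFun_le Q K k g)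

theorem integrable_indicatorFun [IsFiniteMeasure μ] (g : G) :
    Integrable (fun K : Subgroup G => indicatorFun K g) μ := by
  simpa using integrable_avg_pow_indicatorFun (μ := μ) ∅ 0 g

theorem avg_pow_irsTrace [IsFiniteMeasure μ] (Q : Finset G) (k : ℕ) :
    (avg Q ^ k) (irsTrace μ) = fun g => ∫ K, (avg Q ^ k) (indicatorFun K) g ∂μ := by
  induction k with
  | zero => rfl
  | succ k ih =>
    rw [pow_succ', Module.End.mul_apply, ih]
    ext g
    have hint := fun g => integrable_avg_pow_indicatorFun (μ := μ) Q k g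
    simp only [Module.End.mul_apply, avg_apply]
    rw [integral_const_mul, integral_add (hint g) (integrable_finsetSum _ fun q _ => hint _),
      integral_finsetSum _ fun q _ => hint _]

theorem irsTrace_nonneg (μ : Measure (Subgroup G)) (g : G) : 0 ≤ irsTrace μ g :=
  integral_nonneg fun K => indicatorFun_nonneg K g

theorem irsTrace_eq_measureReal (g : G) :
    irsTrace μ g = (μ.real {K : Subgroup G | g ∈ K} : ℂ) := by
  have : (fun K : Subgroup G => indicatorFun K g) =
      {K : Subgroup G | g ∈ K}.indicator fun _ => (1 : ℂ) := by
    ext K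
    by_cases h : g ∈ K <;> simp [indicatorFun, h]
  rw [irsTrace, this, integral_indicator_const _ (isClopen_mem g).isOpen.measurableSet]
  simp

theorem IsIRS.irsTrace_mem_traces (hμ : IsIRS μ) : irsTrace μ ∈ traces G := by
  have hP := hμ.1
  have hinv := hμ.2
  refine ⟨⟨fun n g => ?_, ?_⟩, fun g => ?_⟩
  · rw [Matrix.posSemidef_iff_dotProduct_mulVec]
    have hK := fun K : Subgroup G => (indicatorFun_mem_PD₁ K).1 n g
    refine ⟨?_, fun x => ?_⟩
    · ext i j
      have h1 := fun K => congrFun (congrFun (hK K).isHermitian i) j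
      simp only [Matrix.conjTranspose_apply, Matrix.of_apply, RCLike.star_def, irsTrace] at h1 ⊢
      rw [← integral_conj]
      simp only [h1]
    · have h1 := fun K => (hK K).dotProduct_mulVec_nonneg x
      simp only [dotProduct, Matrix.mulVec, Matrix.of_apply, Pi.star_apply] at h1 ⊢
      have h2 : ∑ i, star (x i) * ∑ j, irsTrace μ ((g i)⁻¹ * g j) * x j =
          ∫ K, ∑ i, star (x i) * ∑ j, indicatorFun K ((g i)⁻¹ * g j) * x j ∂μ := by
        have hint := fun g => integrable_indicatorFun (μ := μ) g
        rw [integral_finsetSum _ fun i _ => (integrable_finsetSum _ fun j _ =>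
          (hint _).mul_const _).const_mul _]
        refine Finset.sum_congr rfl fun i _ => ?_
        rw [integral_const_mul, integral_finsetSum _ fun j _ => (hint _).mul_const _]
        simp only [integral_mul_const, irsTrace]
      rw [h2]
      exact integral_nonneg h1
  · rw [irsTrace_eq_measureReal]
    have : {K : Subgroup G | (1 : G) ∈ K} = Set.univ := Set.eq_univ_of_forall fun K => K.one_mem
    rw [this]
    simp
  · ext x
    rw [conjFun, irsTrace_eq_measureReal, irsTrace_eq_measureReal]
    have h1 := hinv.measure_preimage_smul (ConjAct.toConjAct g) (isClopen_mem x).isOpen.measurableSet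
    have h2 : {K : Subgroup G | g⁻¹ * x * g ∈ K} =
        (fun K => ConjAct.toConjAct g • K) ⁻¹' {K : Subgroup G | x ∈ K} := by
      ext K
      simp only [Set.mem_preimage, Set.mem_ofPred_eq, mem_conj_smul, ConjAct.ofConjAct_toConjAct]
    rw [Measure.real, Measure.real, h2, h1]

theorem null_irsTrace [IsFiniteMeasure μ] (h : ∀ᵐ K ∂μ, Null Q (indicatorFun K)) :
    Null Q (irsTrace μ) := by
  have h1 := tendsto_integral_of_dominated_convergence (μ := μ)
    (F := fun k K => (avg Q ^ k) (indicatorFun K) 1) (f := fun _ => (0 : ℂ)) (fun _ => (1 : ℝ))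
    (fun k => (integrable_avg_pow_indicatorFun Q k 1).aestronglyMeasurable)
    (integrable_const _)
    (fun k => Eventually.of_forall fun K => norm_avg_pow_indicatorFun_le Q K k 1) h
  rw [integral_zero] at h1
  refine h1.congr fun k => ?_
  rw [avg_pow_irsTrace]

/-- If almost every indicator is null, so is the trace of μ; it then vanishes outside the radical,
which almost surely contains K. Otherwise the countable set of finite-index subgroups has positive
measure. -/
theorem IsCharmenable.exists_countable_measure_ne_zero (hG : IsCharmenable G) (hQ : HasGap Q r)
    (hRad : Countable (Subgroup (amenableRadical G))) (hμ : IsIRS μ) :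
    ∃ C : Set (Subgroup G), C.Countable ∧ μ C ≠ 0 := by
  classical
  have := hμ.1
  have := hG.countable
  by_cases hnull : ∀ᵐ K ∂μ, Null Q (indicatorFun K)
  · refine ⟨{K | K ≤ amenableRadical G}, countable_le _, ?_⟩
    have h1 : ∀ᵐ K ∂μ, ∀ g, g ∉ amenableRadical G → g ∉ K := by
      refine ae_all_iff.2 fun g => ?_
      by_cases hg : g ∈ amenableRadical G
      · exact Eventually.of_forall fun K h => absurd hg h
      · have h2 := hG.eq_zero_of_null hQ hμ.irsTrace_mem_traces (irsTrace_nonneg μ)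
          (null_irsTrace hnull) hg
        rw [irsTrace_eq_measureReal, Complex.ofReal_eq_zero, measureReal_eq_zero_iff] at h2
        have h3 : ∀ᵐ K ∂μ, g ∉ K := by
          rw [ae_iff]
          simpa using h2
        exact h3.mono fun K hK _ => hK
    have h2 : ∀ᵐ K ∂μ, K ∈ {K : Subgroup G | K ≤ amenableRadical G} :=
      h1.mono fun K hK g hgK => by_contra fun hg => hK g hg hgK
    intro h0
    obtain ⟨K, hK, hK'⟩ := (h2.and (measure_eq_zero_iff_ae_notMem.1 h0)).exists
    exact hK' hK
  · have hfg : Group.FG G := ⟨⟨Q, hQ.closure_eq_top⟩⟩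
    refine ⟨_, countable_finiteIndex hfg, fun h0 => hnull ?_⟩
    have h1 : ∀ᵐ K ∂μ, K ∉ {K : Subgroup G | K.FiniteIndex} := measure_eq_zero_iff_ae_notMem.1 h0
    exact h1.mono fun K hK => by_contra fun hn => hK (hQ.finiteIndex hn)

/-- A charged countable set contains an atom. Its conjugates have the same mass, so a finite measure
allows only finitely many, and ergodicity gives this orbit full measure. -/
theorem IsErgodicIRS.exists_finite_of_countable (hμ : IsErgodicIRS μ) {C : Set (Subgroup G)}
    (hC : C.Countable) (hμC : μ C ≠ 0) : ∃ F : Set (Subgroup G), F.Finite ∧ μ Fᶜ = 0 := by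
  have := hμ.1.1
  have hinv := hμ.1.2
  obtain ⟨K, hK⟩ : ∃ K, μ {K} ≠ 0 := by
    by_contra! hcon
    rw [← Set.biUnion_of_singleton C] at hμC
    exact hμC ((measure_biUnion_null_iff hC).2 fun K _ => hcon K)
  have hO : ∀ g : ConjAct G, μ {g • K} = μ {K} := fun g => by
    rw [← hinv.measure_preimage_smul g (measurableSet_singleton (g • K))]
    congr 1
    ext L
    simp
  have hfin : (MulAction.orbit (ConjAct G) K).Finite := by
    by_contra hinf
    refine measure_ne_top μ (MulAction.orbit (ConjAct G) K)
      (Set.Infinite.meas_eq_top hinf ⟨μ {K}, hK, ?_⟩)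
    rintro _ ⟨g, rfl⟩
    exact (hO g).ge
  refine ⟨_, hfin, ?_⟩
  have hconst := hμ.2.aeconst_of_forall_preimage_smul_ae_eq hfin.measurableSet fun g => by
    refine Eventually.of_forall fun L => propext ?_
    have h1 : g • L ∈ MulAction.orbit (ConjAct G) K ↔ L ∈ MulAction.orbit (ConjAct G) K :=
      ⟨fun h => by simpa using MulAction.mem_orbit_of_mem_orbit g⁻¹ h,
        MulAction.mem_orbit_of_mem_orbit g⟩
    exact h1
  rw [eventuallyConst_set] at hconst
  rcases hconst with h | h
  · exact h
  · exact absurd (measure_mono_null (Set.singleton_subset_iff.2 (MulAction.mem_orbit_self K))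
      (measure_eq_zero_iff_ae_notMem.2 h)) hK

end IRS

end Charmenability

theorem mainTheorem8 {Λ : Type u} [Group Λ]
    (hcharm : Charmenability.IsCharmenable Λ)
    (hT : Charmenability.HasPropertyT Λ)
    (hRad : Countable (Subgroup (Charmenability.amenableRadical Λ))) :
    (∀ μ : MeasureTheory.Measure (Subgroup Λ), Charmenability.IsErgodicIRS μ →
      ∃ F : Set (Subgroup Λ), F.Finite ∧ μ Fᶜ = 0) ∧
    (∀ X : Set (Subgroup Λ), Charmenability.IsURS X → X.Finite) := by
  obtain ⟨Q, r, hQ⟩ := hT.exists_hasGap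
  refine ⟨fun μ hμ => ?_, fun X hX => hcharm.finite_of_isURS hQ hRad hX⟩
  obtain ⟨C, hC, hμC⟩ := hcharm.exists_countable_measure_ne_zero hQ hRad hμ.1
  exact hμ.exists_finite_of_countable hC hμC
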